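/- Let $r \ge 5$ and $h \ge 1$ be integers, and let $F(x,y) \in \mathbb{Z}[x,y]$ be a diagonalizable binary form of degree $r$, that is, a form that can be written as $$F(x,y) = (\alpha x + \beta y)^r - (\gamma x + \delta y)^r$$ with constants $\alpha,\beta,\gamma,\delta \in \mathbb{C}$ satisfying $\alpha\delta - \beta\gamma \neq 0$. For such a form there are a constant $\chi$ and integers $A, B, C$ with $$(\alpha x + \beta y)(\gamma x + \delta y) = \chi\,(A x^2 + B xy + C y^2);$$ put $D = B^2 - 4AC$ (which is non-zero, and whose sign depends only on $F$). Let $\Delta$ be the discriminant of $F$ and $$\Delta' = \frac{|\Delta|}{2^{r^2-r}\, r^r\, h^{2r-2}}.$$ Let $N_F(h)$ be the number of pairs $(x,y) \in \mathbb{Z}^2$ with $\gcd(x,y) = 1$ and $0 < |F(x,y)| \le h$, where $(x,y)$ and $(-x,-y)$ are counted as one. Call $F$ definite if it takes only positive, or only negative, values on $\mathbb{R}^2 \setminus \{(0,0)\}$, and indefinite if it takes both positive and negative values on $\mathbb{R}^2$. If $$\Delta' \ge r^{7r(r-1)/(r-4)}\, h^{(r-1)(r^2+r+2)/(r(r-4))},$$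 then $N_F(h)$ is finite and $$N_F(h) \le \begin{cases} 3r & \text{if } D < 0,\\ 6 & \text{if } D > 0,\ r \text{ is even and } F \text{ is indefinite},\\ 3 & \text{if } D > 0,\ r \text{ is odd and } F \text{ is indefinite},\\ 1 & \text{if } F \text{ is definite}. \end{cases}$$ -/

import Mathlib

open MvPolynomial

noncomputable section

/-- The value of the binary form `F` at the integer point `(x, y)`. -/
def formEval (F : MvPolynomial (Fin 2) ℤ) (x y : ℤ) : ℤ :=
  MvPolynomial.eval ![x, y] F

/-- The value of the binary form `F` at the real point `(x, y)`. -/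
def formEvalReal (F : MvPolynomial (Fin 2) ℤ) (x y : ℝ) : ℝ :=
  MvPolynomial.aeval ![x, y] F

/-- The linear form `a x + b y` over `ℂ`. -/
def linForm (a b : ℂ) : MvPolynomial (Fin 2) ℂ := C a * X 0 + C b * X 1

/-- `F = (α x + β y)^r - (γ x + δ y)^r` with `α δ - β γ ≠ 0`. -/
structure IsDiagonalization (r : ℕ) (F : MvPolynomial (Fin 2) ℤ) (α β γ δ : ℂ) : Prop where
  det_ne_zero : α * δ - β * γ ≠ 0
  eq_sub : MvPolynomial.map (Int.castRingHom ℂ) F = linForm α β ^ r - linForm γ δ ^ r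

/-- `F` is an integral binary form of degree `r` that is diagonalizable. -/
def IsDiagonalizable (r : ℕ) (F : MvPolynomial (Fin 2) ℤ) : Prop :=
  F.IsHomogeneous r ∧ ∃ α β γ δ : ℂ, IsDiagonalization r F α β γ δ

/-- `D = B² - 4AC` for integers `A`, `B`, `C` and a constant `χ` such that
`(α x + β y)(γ x + δ y) = χ (A x² + B x y + C y²)`, where
`F = (α x + β y)^r - (γ x + δ y)^r` is a diagonalization of `F`.
(`D` is unique up to the square of a nonzero rational number, which stems from rescaling
`A, B, C`; in particular its sign depends on `F` alone if `r ≥ 3`.) -/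
def IsAssociatedD (r : ℕ) (F : MvPolynomial (Fin 2) ℤ) (D : ℤ) : Prop :=
  ∃ (α β γ δ χ : ℂ) (a b c : ℤ), IsDiagonalization r F α β γ δ ∧
    linForm α β * linForm γ δ =
      C χ * (C (a : ℂ) * X 0 ^ 2 + C (b : ℂ) * (X 0 * X 1) + C (c : ℂ) * X 1 ^ 2) ∧
    D = b ^ 2 - 4 * a * c

/-- The polynomial `G(t, 1)`. -/
def dehomogenize (G : MvPolynomial (Fin 2) ℤ) : Polynomial ℤ :=
  MvPolynomial.aeval ![Polynomial.X, 1] G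

/-- The discriminant of a binary form `F` of degree `r`, as
`(-1)^(r(r-1)/2) Res(F_x, F_y) / r^(r-2)`, with the homogeneous resultant of the two partial
derivatives, which are binary forms of degree `r - 1`. For `F = ∏ᵢ (aᵢ x + bᵢ y)` it equals
`∏_{i<j} (aᵢ bⱼ - aⱼ bᵢ)²`. -/
def formDiscr (r : ℕ) (F : MvPolynomial (Fin 2) ℤ) : ℚ :=
  (-1) ^ (r * (r - 1) / 2) *
    (Polynomial.resultant (dehomogenize (pderiv 0 F)) (dehomogenize (pderiv 1 F))
      (r - 1) (r - 1) : ℤ) / (r : ℚ) ^ (r - 2)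

/-- `Δ' = |Δ| / (2^(r²-r) r^r h^(2r-2))`. -/
def deltaPrime (r : ℕ) (F : MvPolynomial (Fin 2) ℤ) (h : ℤ) : ℝ :=
  |(formDiscr r F : ℝ)| / (2 ^ (r ^ 2 - r) * (r : ℝ) ^ r * (h : ℝ) ^ (2 * r - 2))

/-- The primitive integer solutions of `0 < |F(x, y)| ≤ h`. -/
def primitiveSolutions (F : MvPolynomial (Fin 2) ℤ) (h : ℤ) : Set (ℤ × ℤ) :=
  {p | Int.gcd p.1 p.2 = 1 ∧ 0 < |formEval F p.1 p.2| ∧ |formEval F p.1 p.2| ≤ h}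

/-- `N_F(h)`: the number (possibly `⊤`) of primitive solutions of `0 < |F(x, y)| ≤ h`, where
`(x, y)` and `(-x, -y)` count as one solution, that is, the number of unordered pairs
`{p, -p}` with `p` a primitive solution. -/
def numSolutions (F : MvPolynomial (Fin 2) ℤ) (h : ℤ) : ℕ∞ :=
  ((fun p : ℤ × ℤ => s(p, -p)) '' primitiveSolutions F h).encard

/-- `F` takes only positive, or only negative, values at the nonzero real points. -/
def IsDefiniteForm (F : MvPolynomial (Fin 2) ℤ) : Prop :=
  (∀ x y : ℝ, (x, y) ≠ (0, 0) → 0 < formEvalReal F x y) ∨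
    (∀ x y : ℝ, (x, y) ≠ (0, 0) → formEvalReal F x y < 0)

/-- `F` takes both positive and negative values at real points. -/
def IsIndefiniteForm (F : MvPolynomial (Fin 2) ℤ) : Prop :=
  (∃ x y : ℝ, 0 < formEvalReal F x y) ∧ (∃ x y : ℝ, formEvalReal F x y < 0)


/-- Up to a constant factor, a binary quadratic form over `ℂ` of nonzero discriminant is integral
if a multiple of one of its powers is. -/
theorem exists_int_multiple_of_pow (n : ℕ) (hn : n ≠ 0) (κ a b c : ℂ) (hκ : κ ≠ 0)
    (hd : b ^ 2 - 4 * a * c ≠ 0) (G : Polynomial ℤ)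
    (hG : Polynomial.C κ * (Polynomial.C a + Polynomial.C b * Polynomial.X +
      Polynomial.C c * Polynomial.X ^ 2) ^ n = G.map (Int.castRingHom ℂ)) :
    ∃ (χ : ℂ) (a' b' c' : ℤ), a = χ * a' ∧ b = χ * b' ∧ c = χ * c' := by
  have hn' : (n : ℂ) ≠ 0 := by exact_mod_cast hn
  have key : ∀ (m : ℕ) (s t : ℂ), ∃ R : Polynomial ℂ,
      2 * (1 + Polynomial.C s * Polynomial.X + Polynomial.C t * Polynomial.X ^ 2) ^ m =
        2 + 2 * (m : Polynomial ℂ) * Polynomial.C s * Polynomial.X +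
        (2 * (m : Polynomial ℂ) * Polynomial.C t +
          (m : Polynomial ℂ) * ((m : Polynomial ℂ) - 1) * Polynomial.C s ^ 2)
          * Polynomial.X ^ 2 + Polynomial.X ^ 3 * R := by
    intro m s t
    induction m with
    | zero => exact ⟨0, by simp⟩
    | succ m ih =>
      obtain ⟨R, hR⟩ := ih
      refine ⟨R * (1 + Polynomial.C s * Polynomial.X + Polynomial.C t * Polynomial.X ^ 2) +
        2 * (m : Polynomial ℂ) * Polynomial.C s * Polynomial.C t +
        (2 * (m : Polynomial ℂ) * Polynomial.C t +
          (m : Polynomial ℂ) * ((m : Polynomial ℂ) - 1) * Polynomial.C s ^ 2) *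
          (Polynomial.C s + Polynomial.C t * Polynomial.X), ?_⟩
      rw [pow_succ, ← mul_assoc, hR]
      push_cast
      ring
  by_cases ha : a = 0
  · subst ha
    have hb : b ≠ 0 := by
      rintro rfl
      simp at hd
    obtain ⟨R, hR⟩ := key n (c / b) 0
    have e : 2 * G.map (Int.castRingHom ℂ) = (Polynomial.C (κ * b ^ n) *
        (2 + 2 * (n : Polynomial ℂ) * Polynomial.C (c / b) * Polynomial.X +
        (2 * (n : Polynomial ℂ) * Polynomial.C 0 +
          (n : Polynomial ℂ) * ((n : Polynomial ℂ) - 1) * Polynomial.C (c / b) ^ 2)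
          * Polynomial.X ^ 2 + Polynomial.X ^ 3 * R)) * Polynomial.X ^ n := by
      rw [← hR, ← hG]
      have : (Polynomial.C (0 : ℂ) + Polynomial.C b * Polynomial.X +
          Polynomial.C c * Polynomial.X ^ 2) = Polynomial.C b * Polynomial.X *
          (1 + Polynomial.C (c / b) * Polynomial.X + Polynomial.C 0 * Polynomial.X ^ 2) := by
        have : c = b * (c / b) := by field_simp
        conv_lhs => rw [this]
        simp only [Polynomial.C_mul, Polynomial.C_0]
        ring
      rw [this, mul_pow, mul_pow, Polynomial.C_mul, Polynomial.C_pow]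
      ring
    have c0 := congrArg (fun p => Polynomial.coeff p (0 + n)) e
    have c1 := congrArg (fun p => Polynomial.coeff p (1 + n)) e
    simp only [Polynomial.coeff_mul_X_pow, Polynomial.coeff_C_mul, ← Polynomial.C_eq_natCast,
      ← Polynomial.C_ofNat, ← Polynomial.C_mul, ← Polynomial.C_pow, ← Polynomial.C_add,
      ← Polynomial.C_1, ← Polynomial.C_sub,
      Polynomial.coeff_add, Polynomial.coeff_map, Polynomial.coeff_X, Polynomial.coeff_X_pow,
      Polynomial.coeff_C, Polynomial.coeff_X_pow_mul'] at c0 c1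
    norm_num at c0 c1
    have h0 : (G.coeff n : ℂ) = κ * b ^ n := by linear_combination c0 / 2
    have h1 : (G.coeff (1 + n) : ℂ) = κ * b ^ n * (n * (c / b)) := by
      linear_combination c1 / 2
    refine ⟨b / (n * G.coeff n), 0, n * G.coeff n, G.coeff (1 + n), by simp, ?_, ?_⟩
    · push_cast
      rw [h0]
      field_simp
    · rw [h0, h1]
      field_simp
  · obtain ⟨R, hR⟩ := key n (b / a) (c / a)
    have e : 2 * G.map (Int.castRingHom ℂ) = Polynomial.C (κ * a ^ n) *
        (2 + 2 * (n : Polynomial ℂ) * Polynomial.C (b / a) * Polynomial.X +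
        (2 * (n : Polynomial ℂ) * Polynomial.C (c / a) +
          (n : Polynomial ℂ) * ((n : Polynomial ℂ) - 1) * Polynomial.C (b / a) ^ 2)
          * Polynomial.X ^ 2 + Polynomial.X ^ 3 * R) := by
      rw [← hR, ← hG]
      have : (Polynomial.C a + Polynomial.C b * Polynomial.X +
          Polynomial.C c * Polynomial.X ^ 2) = Polynomial.C a *
          (1 + Polynomial.C (b / a) * Polynomial.X +
            Polynomial.C (c / a) * Polynomial.X ^ 2) := by
        have h1 : b = a * (b / a) := by field_simp
        have h2 : c = a * (c / a) := by field_simp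
        conv_lhs => rw [h1, h2]
        simp only [Polynomial.C_mul]
        ring
      rw [this, mul_pow, Polynomial.C_mul, Polynomial.C_pow]
      ring
    have c0 := congrArg (fun p => Polynomial.coeff p 0) e
    have c1 := congrArg (fun p => Polynomial.coeff p 1) e
    have c2 := congrArg (fun p => Polynomial.coeff p 2) e
    simp only [Polynomial.coeff_C_mul, ← Polynomial.C_eq_natCast,
      ← Polynomial.C_ofNat, ← Polynomial.C_mul, ← Polynomial.C_pow, ← Polynomial.C_add,
      ← Polynomial.C_1, ← Polynomial.C_sub,
      Polynomial.coeff_add, Polynomial.coeff_map, Polynomial.coeff_X, Polynomial.coeff_X_pow,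
      Polynomial.coeff_C, Polynomial.coeff_X_pow_mul'] at c0 c1 c2
    norm_num at c0 c1 c2
    have h0 : (G.coeff 0 : ℂ) = κ * a ^ n := by linear_combination c0 / 2
    have h1 : (G.coeff 1 : ℂ) = κ * a ^ n * (n * (b / a)) := by
      linear_combination c1 / 2
    have h2 : (G.coeff 2 : ℂ) =
        κ * a ^ n * (n * (c / a) + n * (n - 1) * (b / a) ^ 2 / 2) := by
      linear_combination c2 / 2
    refine ⟨a / (2 * (n * G.coeff 0) ^ 2), 2 * (n * G.coeff 0) ^ 2,
      2 * n * G.coeff 0 * G.coeff 1,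
      2 * n * G.coeff 0 * G.coeff 2 - (n - 1) * G.coeff 1 ^ 2, ?_, ?_, ?_⟩
    all_goals
      push_cast
      simp only [h0, h1, h2]
      field_simp
    ring

/-- A diagonalizable form of degree at least `3` has an associated integer `D`. -/
theorem IsDiagonalizable.exists_isAssociatedD {r : ℕ} (hr : 3 ≤ r)
    {F : MvPolynomial (Fin 2) ℤ} (hF : IsDiagonalizable r F) : ∃ D, IsAssociatedD r F D := by
  obtain ⟨-, α, β, γ, δ, h⟩ := hF
  obtain ⟨n, rfl⟩ : ∃ n, r = n + 2 := ⟨r - 2, by omega⟩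
  have hn : n ≠ 0 := by omega
  let H := pderiv 0 (pderiv 0 F) * pderiv 1 (pderiv 1 F) - pderiv 0 (pderiv 1 F) ^ 2
  have hH : MvPolynomial.map (Int.castRingHom ℂ) H =
      C (-((n + 2) ^ 2 * (n + 1) ^ 2 * (α * δ - β * γ) ^ 2)) *
        (linForm α β * linForm γ δ) ^ n := by
    have p0 : ∀ a b : ℂ, pderiv (0 : Fin 2) (linForm a b) = C a := by
      intro a b; simp [linForm, pderiv_X]
    have p1 : ∀ a b : ℂ, pderiv (1 : Fin 2) (linForm a b) = C b := by
      intro a b; simp [linForm, pderiv_X]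
    have q0 : ∀ (m : ℕ) (e a b : ℂ), pderiv (0 : Fin 2) (C e * linForm a b ^ (m + 1)) =
        C (e * ((m : ℂ) + 1) * a) * linForm a b ^ m := by
      intro m e a b
      simp [Derivation.leibniz_pow, p0]
      ring
    have q1 : ∀ (m : ℕ) (e a b : ℂ), pderiv (1 : Fin 2) (C e * linForm a b ^ (m + 1)) =
        C (e * ((m : ℂ) + 1) * b) * linForm a b ^ m := by
      intro m e a b
      simp [Derivation.leibniz_pow, p1]
      ring
    have hF : MvPolynomial.map (Int.castRingHom ℂ) F =
        C 1 * linForm α β ^ (n + 1 + 1) - C 1 * linForm γ δ ^ (n + 1 + 1) := by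
      rw [h.eq_sub, C_1, one_mul, one_mul]
    have hmap : MvPolynomial.map (Int.castRingHom ℂ) H =
        pderiv 0 (pderiv 0 (MvPolynomial.map (Int.castRingHom ℂ) F)) *
        pderiv 1 (pderiv 1 (MvPolynomial.map (Int.castRingHom ℂ) F)) -
        pderiv 0 (pderiv 1 (MvPolynomial.map (Int.castRingHom ℂ) F)) ^ 2 := by
      simp only [H, map_sub, map_mul, map_pow, pderiv_map]
    rw [hmap, hF]
    simp only [map_sub, q0, q1]
    simp only [C_mul, C_add, C_sub, C_neg, C_pow, C_1, map_natCast, Nat.cast_add, Nat.cast_one,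
      map_ofNat]
    ring
  have hG := congrArg (MvPolynomial.aeval (R := ℂ) ![1, (Polynomial.X : Polynomial ℂ)]) hH
  have hcomm : MvPolynomial.aeval (R := ℂ) ![1, (Polynomial.X : Polynomial ℂ)]
      (MvPolynomial.map (Int.castRingHom ℂ) H) =
      (MvPolynomial.aeval (R := ℤ) ![1, (Polynomial.X : Polynomial ℤ)] H).map
        (Int.castRingHom ℂ) := by
    induction H using MvPolynomial.induction_on with
    | C a => simp
    | add p q hp hq => simp only [map_add, hp, hq, Polynomial.map_add]
    | mul_X p i hp =>
      simp only [map_mul, hp, Polynomial.map_mul, map_X, aeval_X]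
      congr 1
      fin_cases i <;> simp
  have hlin : ∀ a b : ℂ, MvPolynomial.aeval (R := ℂ) ![1, (Polynomial.X : Polynomial ℂ)]
      (linForm a b) = Polynomial.C a + Polynomial.C b * Polynomial.X := by
    intro a b; simp [linForm, Polynomial.algebraMap_eq]
  rw [hcomm, map_mul, map_pow, map_mul, hlin, hlin] at hG
  obtain ⟨χ, a, b, c, h1, h2, h3⟩ := exists_int_multiple_of_pow n hn
    (-((n + 2) ^ 2 * (n + 1) ^ 2 * (α * δ - β * γ) ^ 2)) (α * γ) (α * δ + β * γ) (β * δ)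
    (by
      have h0 := h.det_ne_zero
      have h2 : (n : ℂ) + 2 ≠ 0 := by exact_mod_cast (Nat.succ_ne_zero (n + 1))
      have h1 : (n : ℂ) + 1 ≠ 0 := by exact_mod_cast (Nat.succ_ne_zero n)
      simp [h0, h1, h2])
    (by
      have := pow_ne_zero 2 h.det_ne_zero
      intro h'; apply this; linear_combination h') _
    (by
      refine Eq.trans ?_ hG.symm
      simp only [aeval_C, Polynomial.algebraMap_eq, Polynomial.C_mul, Polynomial.C_add]
      ring)
  refine ⟨b ^ 2 - 4 * a * c, α, β, γ, δ, χ, a, b, c, h, ?_, rfl⟩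
  have : linForm α β * linForm γ δ = C (α * γ) * X 0 ^ 2 + C (α * δ + β * γ) * (X 0 * X 1)
      + C (β * δ) * X 1 ^ 2 := by
    simp only [linForm, C_mul, C_add]; ring
  rw [this, h1, h2, h3]
  simp only [C_mul]
  ring

end

/-! This is the Thue–Siegel method with Padé approximations to `(1 - z)^(1/r)`. Write ξ = αx + βy, η
= γx + δy, j = αδ - βγ and J = |j|/2. Since |Δ| = r^r |j|^(r(r-1)) (`abs_formDiscr`), Δ' is a
function of J and h, and the hypothesis enters only through r^7 h^3 ≤ J^(r-1) and, for r = 5, h ≤ J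
(`size_bounds`).

Call a solution large if max(|ξ|, |η|)² ≥ J. Two non-proportional integer points satisfy |ξ(p)η(q) -
ξ(q)η(p)| ≥ |j|, so at most one pair ±p is not large. At a large solution |ξ^r - η^r| ≤ h is tiny
compared with |ξ|^r, so η/ξ lies very near a unique r-th root of unity ω (`nearestRoot_spec`). Each
ω belongs to at most two large pairs (`three_large_absurd`), whence N_F(h) ≤ 1 + 2|Ω| for any finite
set Ω containing the roots that occur (`numSolutions_le`).

For the bound two per root, suppose that three large solutions share ω. The determinant inequality
yields a gap principle (`gap`): |ξ| grows roughly like its (r-1)-th power from one solution to the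
next. The first gap makes the middle solution p large enough for Padé approximations at p to be
sharp. Evaluated at p and combined with the third solution q, they give a form that, multiplied by
(2rs)^n, is an integer times j; here s is a square root of the discriminant of the primitive
quadratic form proportional to ξη (`exists_int_padeForm`). Of two consecutive such forms one is
nonzero (`padeForm_ne_zero_or`), and for a suitable n both would be smaller than the resulting lower
bound (`norm_padeForm_le`, `pade_sizes_absurd`).

It remains to see which ω occur. In general there are at most r, giving 1 + 2r ≤ 3r. If D > 0, then
s is real and two roots differ by a real r-th root of unity (`nearestRoot_div_real`): two values of
ω at most, one if r is odd, giving 5 and 3. A large solution forces a nontrivial real zero of F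
(`exists_real_zero`), so a definite form has none and only the one small pair remains. -/

noncomputable section

/-! ### The discriminant of a diagonal form -/

/-- Resultant of two linear combinations of the same pair of polynomials. -/
theorem resultant_linear_comb {K : Type*} [Field K] (a b c d : K) (U V : Polynomial K) (n : ℕ)
    (hU : U.natDegree ≤ n) (hV : V.natDegree ≤ n) :
    Polynomial.resultant (Polynomial.C a * U + Polynomial.C b * V)
      (Polynomial.C c * U + Polynomial.C d * V) n n =
      (a * d - b * c) ^ n * Polynomial.resultant U V n n := by
  have hsq : ((-1 : K)) ^ (n * n) = (-1) ^ n := by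
    rw [pow_mul]
    rcases Nat.even_or_odd n with h | h
    · simp [h.neg_one_pow]
    · simp [h.neg_one_pow]
  -- Row reduction with pivot `a`. Without a pivot the two polynomials are swapped, at the cost of
  -- the sign (-1)^(n²) = (-1)^n.
  by_cases ha : a = 0
  · subst ha
    have h1 : Polynomial.C c * U + Polynomial.C d * V =
        Polynomial.C c * U + V * Polynomial.C d := by ring
    rw [Polynomial.C_0, zero_mul, zero_add, Polynomial.resultant_C_mul_left, h1,
      Polynomial.resultant_add_mul_right _ _ _ _ _ (by simp) hV,
      Polynomial.resultant_C_mul_right, Polynomial.resultant_comm, hsq,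
      show (0 * d - b * c) = (-1) * (b * c) by ring, mul_pow, mul_pow]
    ring
  · have h1 : Polynomial.C c * U + Polynomial.C d * V =
        Polynomial.C ((a * d - b * c) / a) * V +
          (Polynomial.C a * U + Polynomial.C b * V) * Polynomial.C (c / a) := by
      have e1 : c = a * (c / a) := by field_simp
      have e2 : d = (a * d - b * c) / a + b * (c / a) := by field_simp; ring
      conv_lhs => rw [e1, e2]
      simp only [Polynomial.C_mul, Polynomial.C_add]
      ring
    have hdeg : (Polynomial.C a * U + Polynomial.C b * V).natDegree ≤ n :=
      Polynomial.natDegree_add_le_of_degree_le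
        ((Polynomial.natDegree_C_mul_le _ _).trans hU) ((Polynomial.natDegree_C_mul_le _ _).trans hV)
    have h2 : Polynomial.C a * U + Polynomial.C b * V =
        Polynomial.C a * U + V * Polynomial.C b := by ring
    rw [h1, Polynomial.resultant_add_mul_right _ _ _ _ _ (by simp) hdeg,
      Polynomial.resultant_C_mul_right, h2, Polynomial.resultant_add_mul_left _ _ _ _ _ (by simp) hV,
      Polynomial.resultant_C_mul_left, ← mul_assoc, ← mul_pow]
    congr 2
    field_simp

/-- Resultant of `n`-th powers of two linear polynomials. -/
theorem resultant_linear_pow {K : Type*} [Field K] (α β γ δ : K) (n : ℕ) :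
    Polynomial.resultant ((Polynomial.C α * Polynomial.X + Polynomial.C β) ^ n)
      ((Polynomial.C γ * Polynomial.X + Polynomial.C δ) ^ n) n n =
      (α * δ - β * γ) ^ (n * n) := by
  have hdeg : ((Polynomial.C γ * Polynomial.X + Polynomial.C δ) ^ n).natDegree ≤ n := by
    refine Polynomial.natDegree_pow_le.trans ?_
    have := Polynomial.natDegree_linear_le (a := γ) (b := δ)
    nlinarith
  by_cases hα : α = 0
  · subst hα
    have hc : ((Polynomial.C γ * Polynomial.X + Polynomial.C δ) ^ n).coeff n = γ ^ n := by
      have := Polynomial.coeff_pow_of_natDegree_le (m := n)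
        (Polynomial.natDegree_linear_le (a := γ) (b := δ))
      simpa using this
    rw [Polynomial.C_0, zero_mul, zero_add, ← Polynomial.C_pow, Polynomial.resultant_C_left, hc]
    rw [show (0 * δ - β * γ) = (-1) * γ * β by ring, mul_pow, mul_pow, pow_mul, pow_mul, pow_mul]
  · have h1 : (Polynomial.C α * Polynomial.X + Polynomial.C β) ^ n =
        Polynomial.C (α ^ n) * (Polynomial.X - Polynomial.C (-(β / α))) ^ n := by
      rw [Polynomial.C_pow, ← mul_pow, mul_sub, ← Polynomial.C_mul]
      congr 1
      rw [show α * -(β / α) = -β by field_simp]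
      simp
    rw [h1, Polynomial.resultant_C_mul_left, Polynomial.resultant_X_sub_C_pow_left _ _ _ _ hdeg]
    simp only [Polynomial.eval_pow, Polynomial.eval_add, Polynomial.eval_mul, Polynomial.eval_C,
      Polynomial.eval_X]
    rw [← pow_mul, ← pow_mul, ← mul_pow]
    congr 1
    field_simp
    ring

theorem map_dehomogenize (G : MvPolynomial (Fin 2) ℤ) :
    (dehomogenize G).map (Int.castRingHom ℂ) =
      MvPolynomial.aeval (R := ℂ) ![(Polynomial.X : Polynomial ℂ), 1]
        (MvPolynomial.map (Int.castRingHom ℂ) G) := by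
  unfold dehomogenize
  induction G using MvPolynomial.induction_on with
  | C a => simp
  | add p q hp hq => simp only [map_add, hp, hq, Polynomial.map_add]
  | mul_X p i hp =>
    simp only [map_mul, hp, Polynomial.map_mul, map_X, aeval_X]
    congr 1
    fin_cases i <;> simp

theorem pderiv_zero_linForm (a b : ℂ) : pderiv (0 : Fin 2) (linForm a b) = C a := by
  simp [linForm, pderiv_X]

theorem pderiv_one_linForm (a b : ℂ) : pderiv (1 : Fin 2) (linForm a b) = C b := by
  simp [linForm, pderiv_X]

theorem IsDiagonalization.pderiv_zero {r : ℕ} {F : MvPolynomial (Fin 2) ℤ} {α β γ δ : ℂ}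
    (h : IsDiagonalization r F α β γ δ) :
    MvPolynomial.map (Int.castRingHom ℂ) (pderiv 0 F) =
      C (r : ℂ) * (C α * linForm α β ^ (r - 1) - C γ * linForm γ δ ^ (r - 1)) := by
  rw [← pderiv_map, h.eq_sub, map_sub, Derivation.leibniz_pow, Derivation.leibniz_pow,
    pderiv_zero_linForm, pderiv_zero_linForm]
  simp
  ring

theorem IsDiagonalization.pderiv_one {r : ℕ} {F : MvPolynomial (Fin 2) ℤ} {α β γ δ : ℂ}
    (h : IsDiagonalization r F α β γ δ) :
    MvPolynomial.map (Int.castRingHom ℂ) (pderiv 1 F) =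
      C (r : ℂ) * (C β * linForm α β ^ (r - 1) - C δ * linForm γ δ ^ (r - 1)) := by
  rw [← pderiv_map, h.eq_sub, map_sub, Derivation.leibniz_pow, Derivation.leibniz_pow,
    pderiv_one_linForm, pderiv_one_linForm]
  simp
  ring

/-- Both partial derivatives are r times linear combinations of ξ^(r-1) and η^(r-1). With j = αδ -
βγ, the combination contributes (-j)^(r-1) to the resultant and the two powers contribute
j^((r-1)²). The factor r^(2(r-1)) over r^(r-2) leaves r^r. -/
theorem IsDiagonalization.abs_formDiscr {r : ℕ} (hr : 2 ≤ r) {F : MvPolynomial (Fin 2) ℤ}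
    {α β γ δ : ℂ} (h : IsDiagonalization r F α β γ δ) :
    |(formDiscr r F : ℝ)| = (r : ℝ) ^ r * ‖α * δ - β * γ‖ ^ (r ^ 2 - r) := by
  obtain ⟨n, rfl⟩ : ∃ n, r = n + 2 := ⟨r - 2, by omega⟩
  have hlin : ∀ a b : ℂ, MvPolynomial.aeval (R := ℂ) ![(Polynomial.X : Polynomial ℂ), 1]
      (linForm a b) = Polynomial.C a * Polynomial.X + Polynomial.C b := by
    intro a b; simp [linForm, Polynomial.algebraMap_eq]
  have hdeg : ∀ a b : ℂ,
      ((Polynomial.C a * Polynomial.X + Polynomial.C b) ^ (n + 1)).natDegree ≤ n + 1 := by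
    intro a b
    refine Polynomial.natDegree_pow_le.trans ?_
    have := Polynomial.natDegree_linear_le (a := a) (b := b)
    nlinarith
  have h0 := map_dehomogenize (pderiv 0 F)
  have h1 := map_dehomogenize (pderiv 1 F)
  rw [h.pderiv_zero] at h0
  rw [h.pderiv_one] at h1
  simp only [map_mul, map_sub, map_pow, hlin, aeval_C, Polynomial.algebraMap_eq,
    Nat.add_succ_sub_one] at h0 h1
  have hres : ((Polynomial.resultant (dehomogenize (pderiv 0 F)) (dehomogenize (pderiv 1 F))
      (n + 1) (n + 1) : ℤ) : ℂ) = ((n + 2 : ℕ) : ℂ) ^ (2 * (n + 1)) *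
        ((-1) * (α * δ - β * γ)) ^ (n + 1) * (α * δ - β * γ) ^ ((n + 1) * (n + 1)) := by
    rw [← eq_intCast (Int.castRingHom ℂ), ← Polynomial.resultant_map_map, h0, h1]
    rw [Polynomial.resultant_C_mul_left, Polynomial.resultant_C_mul_right]
    rw [← resultant_linear_pow α β γ δ (n + 1)]
    have := resultant_linear_comb α (-γ) β (-δ)
      ((Polynomial.C α * Polynomial.X + Polynomial.C β) ^ (n + 1))
      ((Polynomial.C γ * Polynomial.X + Polynomial.C δ) ^ (n + 1)) (n + 1) (hdeg _ _) (hdeg _ _)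
    rw [Polynomial.C_neg, Polynomial.C_neg, neg_mul, neg_mul, ← sub_eq_add_neg,
      ← sub_eq_add_neg] at this
    rw [this]
    ring
  have hnorm : |((Polynomial.resultant (dehomogenize (pderiv 0 F)) (dehomogenize (pderiv 1 F))
      (n + 1) (n + 1) : ℤ) : ℝ)| = ((n + 2 : ℕ) : ℝ) ^ (2 * (n + 1)) *
        ‖α * δ - β * γ‖ ^ ((n + 2) * (n + 1)) := by
    rw [← Complex.norm_intCast, hres]
    simp only [norm_mul, norm_pow, norm_neg, norm_one, Complex.norm_natCast, one_mul]
    ring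
  have hpos : (0 : ℝ) < ((n + 2 : ℕ) : ℝ) := by positivity
  unfold formDiscr
  simp only [Nat.add_sub_cancel, Nat.add_succ_sub_one]
  push_cast [Rat.cast_div, Rat.cast_mul, Rat.cast_pow]
  push_cast at hnorm hpos
  rw [abs_div, abs_mul, abs_pow, abs_neg, abs_one, one_pow, one_mul, hnorm, abs_pow,
    abs_of_pos hpos, show (n + 2) ^ 2 - (n + 2) = (n + 2) * (n + 1) by
      rw [pow_two, ← Nat.mul_sub_one]; simp]
  rw [div_eq_iff (by positivity)]
  ring

/-! ### Integrality and size of the Padé coefficients -/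

/-- `k!` divides `r ^ k` times any product of `k` consecutive terms of an arithmetic progression
with difference `r`. -/
theorem factorial_dvd_pow_mul_prod (r : ℤ) (k : ℕ) (a : ℤ) :
    (k.factorial : ℤ) ∣ r ^ k * ∏ i ∈ Finset.range k, (a + r * i) := by
  rw [Int.natCast_dvd, Nat.dvd_iff_prime_pow_dvd_dvd]
  intro p e hp he
  rw [← Int.natCast_dvd]
  -- If p divides r, the factor r^k suffices, because the exponent of p in k! is at most k.
  -- Otherwise r is invertible modulo p^e, and multiplying by the inverse turns the progression into
  -- k consecutive integers.
  by_cases hpr : (p : ℤ) ∣ r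
  · have hek : e ≤ k := by
      have := Fact.mk hp
      exact ((padicValNat_dvd_iff_le (p := p) (Nat.factorial_ne_zero k)).1 he).trans
        (padicValNat_factorial_le (p := p) k)
    refine Dvd.dvd.mul_right ?_ _
    push_cast
    exact (pow_dvd_pow _ hek).trans (pow_dvd_pow_of_dvd hpr k)
  · refine Dvd.dvd.mul_left ?_ _
    have hcop : IsCoprime ((p ^ e : ℕ) : ℤ) r := by
      push_cast
      exact IsCoprime.pow_left ((Nat.prime_iff_prime_int.1 hp).coprime_iff_not_dvd.2 hpr)
    obtain ⟨t, s, hts⟩ := hcop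
    have hcop' : IsCoprime ((p ^ e : ℕ) : ℤ) (s ^ k) :=
      IsCoprime.pow_right ⟨t, r, by linear_combination hts⟩
    refine hcop'.dvd_of_dvd_mul_left ?_
    have h1 : s ^ k * ∏ i ∈ Finset.range k, (a + r * i) =
        ∏ i ∈ Finset.range k, (s * a + s * r * i) := by
      rw [← Finset.card_range k, ← Finset.prod_const, Finset.card_range, ← Finset.prod_mul_distrib]
      exact Finset.prod_congr rfl fun i _ => by ring
    have h2 : ∏ i ∈ Finset.range k, (s * a + s * r * i) ≡ ∏ i ∈ Finset.range k, (s * a + i)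
        [ZMOD ((p ^ e : ℕ) : ℤ)] := by
      refine Int.ModEq.prod fun i _ => ?_
      rw [Int.modEq_iff_dvd]
      exact ⟨t * i, by linear_combination (i : ℤ) * (-1) * hts⟩
    rw [h1]
    refine (Int.ModEq.dvd_iff h2).2 ?_
    refine dvd_trans ?_ (Nat.factorial_coe_dvd_prod k (s * a))
    exact_mod_cast he

/-- `∏ (r m + 1)` over `1 ≤ m ≤ k`. -/
def prodPlus (r k : ℕ) : ℝ := ∏ m ∈ Finset.range k, ((r : ℝ) * (m + 1) + 1)

/-- `∏ (r m - 1)` over `1 ≤ m ≤ k`. -/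
def prodMinus (r k : ℕ) : ℝ := ∏ m ∈ Finset.range k, ((r : ℝ) * (m + 1) - 1)

theorem prodPlus_pos (r k : ℕ) : 0 < prodPlus r k :=
  Finset.prod_pos fun _ _ => by positivity

theorem prodMinus_pos {r : ℕ} (hr : 2 ≤ r) (k : ℕ) : 0 < prodMinus r k :=
  Finset.prod_pos fun m _ => by
    have : (2 : ℝ) ≤ r := by exact_mod_cast hr
    have : (0 : ℝ) ≤ m := by positivity
    nlinarith

/-- Normalizing factor of the Padé approximations to `(1 - z) ^ (1 / r)`. -/
def padeNorm (r n : ℕ) : ℝ := prodPlus r n * prodMinus r n / (n.factorial : ℝ) ^ 2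

/-- Coefficients of the Padé approximations to `(1 - z) ^ (1 / r)`, normalized to be integers. -/
def padeCoeff (r n l : ℕ) : ℝ :=
  padeNorm r n * (n.choose l * n.factorial * (r : ℝ) ^ n / (prodMinus r (n - l) * prodPlus r l))

theorem padeCoeff_pos {r : ℕ} (hr : 2 ≤ r) {n l : ℕ} (hl : l ≤ n) : 0 < padeCoeff r n l := by
  have := prodMinus_pos hr n
  have := prodMinus_pos hr (n - l)
  have := prodPlus_pos r n
  have := prodPlus_pos r l
  have : 0 < n.choose l := Nat.choose_pos hl
  unfold padeCoeff padeNorm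
  positivity

theorem padeCoeff_int {r : ℕ} (hr : 2 ≤ r) {n l : ℕ} (hl : l ≤ n) :
    ∃ c : ℤ, padeCoeff r n l = c := by
  obtain ⟨k, rfl⟩ := Nat.exists_eq_add_of_le hl
  -- After cancelling `prodPlus r l` and `prodMinus r k` from the normalizing factor, k and l terms
  -- of progressions with difference r remain. The factorials reduce to 1/(l! k!), and r^n splits as
  -- r^k r^l, one power for each progression.
  obtain ⟨x, hx⟩ := factorial_dvd_pow_mul_prod r k (r * (l + 1) + 1)
  obtain ⟨y, hy⟩ := factorial_dvd_pow_mul_prod r l (r * (k + 1) - 1)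
  refine ⟨x * y, ?_⟩
  have hP : prodPlus r (l + k) = prodPlus r l *
      ((∏ i ∈ Finset.range k, ((r * (l + 1) + 1) + r * i) : ℤ) : ℝ) := by
    unfold prodPlus
    rw [Finset.prod_range_add]
    push_cast
    congr 1
    exact Finset.prod_congr rfl fun i _ => by ring
  have hM : prodMinus r (l + k) = prodMinus r k *
      ((∏ i ∈ Finset.range l, ((r * (k + 1) - 1) + r * i) : ℤ) : ℝ) := by
    unfold prodMinus
    rw [add_comm l k, Finset.prod_range_add]
    push_cast
    congr 1
    exact Finset.prod_congr rfl fun i _ => by ring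
  have hx' := congrArg (fun z : ℤ => (z : ℝ)) hx
  have hy' := congrArg (fun z : ℤ => (z : ℝ)) hy
  simp only [Int.cast_mul, Int.cast_pow, Int.cast_natCast] at hx' hy'
  have hch : ((l + k).choose l : ℝ) * (l.factorial * k.factorial) = (l + k).factorial := by
    have := Nat.choose_mul_factorial_mul_factorial (Nat.le_add_right l k)
    rw [Nat.add_sub_cancel_left] at this
    rw [← this]; push_cast; ring
  have h1 := (prodPlus_pos r l).ne'
  have h2 := (prodMinus_pos hr k).ne'
  have h3 : (l.factorial : ℝ) ≠ 0 := by positivity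
  have h4 : (k.factorial : ℝ) ≠ 0 := by positivity
  have h5 : ((l + k).factorial : ℝ) ≠ 0 := by positivity
  unfold padeCoeff padeNorm
  rw [Nat.add_sub_cancel_left, hP, hM]
  push_cast
  push_cast at hx' hy'
  set PP := ∏ i ∈ Finset.range k, ((r : ℝ) * (l + 1) + 1 + r * i)
  set QQ := ∏ i ∈ Finset.range l, ((r : ℝ) * (k + 1) - 1 + r * i)
  have hx2 : (x : ℝ) = r ^ k * PP / k.factorial := by rw [hx']; field_simp
  have hy2 : (y : ℝ) = r ^ l * QQ / l.factorial := by rw [hy']; field_simp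
  have hch2 : ((l + k).choose l : ℝ) = (l + k).factorial / (l.factorial * k.factorial) := by
    rw [← hch]; field_simp
  rw [hx2, hy2, hch2, pow_add]
  field_simp

theorem padeNorm_pos {r : ℕ} (hr : 2 ≤ r) (n : ℕ) : 0 < padeNorm r n := by
  have := prodMinus_pos hr n
  have := prodPlus_pos r n
  unfold padeNorm
  positivity

theorem prod_range_mul_succ (x : ℝ) (n : ℕ) :
    ∏ m ∈ Finset.range n, (x * ((m : ℝ) + 1)) = x ^ n * n.factorial := by
  rw [Finset.prod_mul_distrib, Finset.prod_const, Finset.card_range,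
    ← Finset.prod_range_add_one_eq_factorial]
  push_cast
  rfl

/-- Termwise (rm + 1)(rm - 1) ≤ (rm)². -/
theorem padeNorm_le {r : ℕ} (hr : 2 ≤ r) (n : ℕ) : padeNorm r n ≤ ((r : ℝ) ^ 2) ^ n := by
  unfold padeNorm
  rw [div_le_iff₀ (by positivity), ← pow_mul, mul_comm 2 n, pow_mul, ← mul_pow,
    ← prod_range_mul_succ, ← Finset.prod_pow, prodPlus, prodMinus, ← Finset.prod_mul_distrib]
  have : (2 : ℝ) ≤ r := by exact_mod_cast hr
  refine Finset.prod_le_prod (fun m _ => ?_) fun m _ => ?_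
  · have : (0 : ℝ) ≤ m := by positivity
    exact mul_nonneg (by positivity) (by nlinarith)
  · nlinarith

/-- Replacing rm + 1 by rm and rm - 1 by rm/2 in the denominators bounds each coefficient by (2r²)^n
times the square of a binomial coefficient. The sum of those squares is at most 4^n. -/
theorem padeCoeff_sum_le {r : ℕ} (hr : 2 ≤ r) (n : ℕ) :
    ∑ l ∈ Finset.range (n + 1), padeCoeff r n l ≤ (8 * (r : ℝ) ^ 2) ^ n := by
  have hr' : (2 : ℝ) ≤ r := by exact_mod_cast hr
  have hle : ∀ l ∈ Finset.range (n + 1), padeCoeff r n l ≤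
      (2 * (r : ℝ) ^ 2) ^ n * (n.choose l * n.choose l) := by
    intro l hl
    have hl : l ≤ n := by simpa [Nat.lt_succ_iff] using hl
    have h1 : (r : ℝ) ^ l * l.factorial ≤ prodPlus r l := by
      rw [← prod_range_mul_succ]
      exact Finset.prod_le_prod (fun m _ => by positivity) fun m _ => by linarith
    have h2 : ((r : ℝ) / 2) ^ (n - l) * (n - l).factorial ≤ prodMinus r (n - l) := by
      rw [← prod_range_mul_succ]
      refine Finset.prod_le_prod (fun m _ => by positivity) fun m _ => ?_
      have : (0 : ℝ) ≤ m := by positivity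
      nlinarith
    have h3 : (n.factorial : ℝ) = n.choose l * (l.factorial * (n - l).factorial) := by
      rw [← Nat.choose_mul_factorial_mul_factorial hl]; push_cast; ring
    have h4 : (r : ℝ) ^ n = r ^ l * ((r : ℝ) / 2) ^ (n - l) * 2 ^ (n - l) := by
      rw [mul_assoc, ← mul_pow, div_mul_cancel₀ _ two_ne_zero, ← pow_add, Nat.add_sub_cancel' hl]
    have h5 : (2 : ℝ) ^ (n - l) ≤ 2 ^ n := pow_le_pow_right₀ (by norm_num) (Nat.sub_le _ _)
    have h6 : (n.choose l * n.factorial * (r : ℝ) ^ n / (prodMinus r (n - l) * prodPlus r l)) ≤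
        2 ^ n * (n.choose l * n.choose l) := by
      rw [div_le_iff₀ (mul_pos (prodMinus_pos hr _) (prodPlus_pos r _))]
      calc (n.choose l * n.factorial * (r : ℝ) ^ n)
          = 2 ^ (n - l) * (n.choose l * n.choose l) *
            ((((r : ℝ) / 2) ^ (n - l) * (n - l).factorial) * ((r : ℝ) ^ l * l.factorial)) := by
            rw [h4, h3]; ring
        _ ≤ 2 ^ n * (n.choose l * n.choose l) * (prodMinus r (n - l) * prodPlus r l) := by
            have := prodMinus_pos hr (n - l)
            gcongr
    calc padeCoeff r n l ≤ ((r : ℝ) ^ 2) ^ n * (2 ^ n * (n.choose l * n.choose l)) := by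
          unfold padeCoeff
          have h7 := padeNorm_le hr n
          have h8 := (padeNorm_pos hr n).le
          have := prodMinus_pos hr (n - l)
          have := prodPlus_pos r l
          gcongr
      _ = _ := by rw [mul_pow]; ring
  refine (Finset.sum_le_sum hle).trans ?_
  rw [← Finset.mul_sum]
  have h9 : ∑ l ∈ Finset.range (n + 1), ((n.choose l : ℝ) * n.choose l) ≤ 4 ^ n := by
    have hs : ∑ l ∈ Finset.range (n + 1), (n.choose l : ℝ) = 2 ^ n := by
      exact_mod_cast Nat.sum_range_choose n
    calc ∑ l ∈ Finset.range (n + 1), ((n.choose l : ℝ) * n.choose l)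
        ≤ ∑ l ∈ Finset.range (n + 1), ((n.choose l : ℝ) * 2 ^ n) := by
          refine Finset.sum_le_sum fun l hl => ?_
          gcongr
          exact_mod_cast Nat.choose_le_two_pow n l
      _ = 4 ^ n := by
          rw [← Finset.sum_mul, hs, ← mul_pow]; norm_num
  calc (2 * (r : ℝ) ^ 2) ^ n * ∑ l ∈ Finset.range (n + 1), ((n.choose l : ℝ) * n.choose l)
      ≤ (2 * (r : ℝ) ^ 2) ^ n * 4 ^ n := by gcongr
    _ = _ := by rw [← mul_pow]; ring

/-! ### The integral formula for the Padé remainder -/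

/-- Partial fraction decomposition of `n! / (x (x + 1) ⋯ (x + n))`. -/
theorem sum_choose_div_add {K : Type*} [Field K] (n : ℕ) (x : K) (hx : ∀ i : ℕ, x + i ≠ 0) :
    ∑ k ∈ Finset.range (n + 1), (-1) ^ k * (n.choose k : K) / (x + k) =
      n.factorial / ∏ i ∈ Finset.range (n + 1), (x + i) := by
  induction n generalizing x with
  | zero => simp
  | succ n ih =>
    have hx' : ∀ i : ℕ, (x + 1) + i ≠ 0 := fun i => by
      have := hx (i + 1); push_cast at this; rwa [add_assoc, add_comm 1]
    have h1 := ih x hx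
    have h2 := ih (x + 1) hx'
    have h3 : ∑ k ∈ Finset.range (n + 2), (-1) ^ k * ((n + 1).choose k : K) / (x + k) =
        (∑ k ∈ Finset.range (n + 1), (-1) ^ k * (n.choose k : K) / (x + k)) -
        ∑ k ∈ Finset.range (n + 1), (-1) ^ k * (n.choose k : K) / (x + 1 + k) := by
      have e1 : ∑ k ∈ Finset.range (n + 1), (-1) ^ k * (n.choose k : K) / (x + k) =
          ∑ k ∈ Finset.range (n + 2), (-1) ^ k * (n.choose k : K) / (x + k) := by
        rw [Finset.sum_range_succ _ (n + 1)]; simp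
      rw [e1, Finset.sum_range_succ' _ (n + 1), Finset.sum_range_succ' _ (n + 1)]
      rw [add_sub_right_comm, ← Finset.sum_sub_distrib]
      congr 1
      · refine Finset.sum_congr rfl fun k _ => ?_
        rw [Nat.choose_succ_succ]
        have := hx' k
        have h4 : x + ((k + 1 : ℕ) : K) = x + 1 + k := by push_cast; ring
        rw [h4]
        push_cast
        field_simp
        ring
      · simp
    rw [h3, h1, h2, Finset.prod_range_succ' _ (n + 1), Nat.factorial_succ]
    have e2 : ∏ i ∈ Finset.range (n + 1), (x + ((i + 1 : ℕ) : K)) =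
        ∏ i ∈ Finset.range (n + 1), (x + 1 + i) :=
      Finset.prod_congr rfl fun i _ => by push_cast; ring
    have e3 : (∏ i ∈ Finset.range (n + 1), (x + i)) * (x + ((n + 1 : ℕ) : K)) =
        (∏ i ∈ Finset.range (n + 1), (x + 1 + i)) * x := by
      rw [← Finset.prod_range_succ, Finset.prod_range_succ' _ (n + 1), e2]
      simp
    have n1 : ∏ i ∈ Finset.range (n + 1), (x + (i : K)) ≠ 0 :=
      Finset.prod_ne_zero_iff.2 fun i _ => hx i
    have n2 : ∏ i ∈ Finset.range (n + 1), (x + 1 + (i : K)) ≠ 0 :=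
      Finset.prod_ne_zero_iff.2 fun i _ => hx' i
    have n3 : x ≠ 0 := by simpa using hx 0
    rw [e2]
    simp only [Nat.cast_zero, add_zero]
    push_cast at e3 ⊢
    set A := ∏ i ∈ Finset.range (n + 1), (x + (i : K))
    set B := ∏ i ∈ Finset.range (n + 1), (x + 1 + (i : K))
    field_simp
    linear_combination (n.factorial : K) * (-1) * e3

/-- These are the denominators that appear when the powers v^(rm) are integrated: the exponent -1
never occurs. -/
theorem natCast_mul_intCast_add_one_ne_zero {r : ℕ} (hr : 2 ≤ r) (m : ℤ) :
    (r : ℝ) * m + 1 ≠ 0 := by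
  intro h
  have h' : (r : ℤ) * m = -1 := by
    have : ((r : ℤ) * m + 1 : ℤ) = 0 := by exact_mod_cast h
    linarith
  have hd : (r : ℤ) ∣ 1 := ⟨-m, by linarith⟩
  have := Int.le_of_dvd one_pos hd
  omega

/-- Factor number i is (r(i - (n - l)) + 1)/r. The factors with i < n - l give `prodMinus` with
signs, the one with i = n - l gives 1/r, and the later ones give `prodPlus`. -/
theorem prod_shifted_progression {r : ℕ} (hr : 2 ≤ r) {n l : ℕ} (hl : l ≤ n) :
    ∏ i ∈ Finset.range (n + 1), (((l : ℝ) - n + 1 / r) + i) =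
      (-1) ^ (n - l) * (prodMinus r (n - l) * prodPlus r l) / (r : ℝ) ^ (n + 1) := by
  obtain ⟨k, rfl⟩ := Nat.exists_eq_add_of_le' hl
  have hr0 : (r : ℝ) ≠ 0 := by positivity
  have h1 : ∀ i : ℕ, (((l : ℝ) - (k + l : ℕ) + 1 / r) + i) = (r * ((i : ℝ) - k) + 1) / r := by
    intro i; push_cast; field_simp; ring
  simp only [h1]
  rw [Finset.prod_div_distrib, Finset.prod_const, Finset.card_range, Nat.add_sub_cancel]
  congr 1
  rw [add_assoc, Finset.prod_range_add, ← mul_assoc]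
  congr 1
  · rw [← Finset.prod_range_reflect, prodMinus, ← Finset.card_range k, ← Finset.prod_const,
      Finset.card_range, ← Finset.prod_mul_distrib]
    refine Finset.prod_congr rfl fun i hi => ?_
    have hi : i < k := by simpa using hi
    rw [Nat.sub_sub, Nat.cast_sub (by omega)]
    push_cast
    ring
  · rw [Finset.prod_range_succ', prodPlus]
    simp

/-- The coefficients of the Padé approximations in terms of their integral representation. -/
theorem padeCoeff_eq_sum {r : ℕ} (hr : 2 ≤ r) {n l : ℕ} (hl : l ≤ n) :
    padeNorm r n * ∑ k ∈ Finset.range (n + 1), (-1) ^ (n + k + l) * (n.choose k * n.choose l) /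
      (r * ((k : ℝ) + l - n) + 1) = padeCoeff r n l := by
  have hr0 : (r : ℝ) ≠ 0 := by positivity
  have hx : ∀ i : ℕ, ((l : ℝ) - n + 1 / r) + i ≠ 0 := by
    intro i h
    refine natCast_mul_intCast_add_one_ne_zero hr (l - n + i) ?_
    push_cast
    field_simp at h
    linarith
  have h1 := sum_choose_div_add n _ hx
  rw [prod_shifted_progression hr hl] at h1
  have h2 : ∑ k ∈ Finset.range (n + 1), (-1) ^ (n + k + l) * ((n.choose k : ℝ) * n.choose l) /
      (r * ((k : ℝ) + l - n) + 1) = (-1) ^ (n + l) * n.choose l / r *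
      ∑ k ∈ Finset.range (n + 1), (-1) ^ k * (n.choose k : ℝ) / (((l : ℝ) - n + 1 / r) + k) := by
    rw [Finset.mul_sum]
    refine Finset.sum_congr rfl fun k _ => ?_
    have e : (((l : ℝ) - n + 1 / r) + k) = (r * ((k : ℝ) + l - n) + 1) / r := by
      field_simp; ring
    have e2 : (r * ((k : ℝ) + l - n) + 1) ≠ 0 := by
      have := natCast_mul_intCast_add_one_ne_zero hr (k + l - n)
      push_cast at this
      exact this
    rw [e, pow_add, pow_add, pow_add]
    field_simp
  have hs : (-1 : ℝ) ^ (n - l) = (-1) ^ (n + l) := by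
    have : n + l = (n - l) + 2 * l := by omega
    rw [this, pow_add, pow_mul]; simp
  rw [h2, h1, hs, padeCoeff]
  have h3 := (prodMinus_pos hr (n - l)).ne'
  have h4 := (prodPlus_pos r l).ne'
  have h5 : ((-1 : ℝ)) ^ (n + l) ≠ 0 := pow_ne_zero _ (by norm_num)
  field_simp
  ring

/-- The integral giving the remainder of the Padé approximation at `exp (r L)`. -/
def padeIntegral (r n : ℕ) (L : ℂ) : ℂ :=
  ∫ s in (0 : ℝ)..1, L * (Complex.exp (s * L) *
    ((Complex.exp (r * s * L) - 1) * (Complex.exp (r * (1 - s) * L) - 1)) ^ n)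

/-- With v = exp(sL) and Z = exp(rL) the integral is that of ((v^r - 1)(Z v^(-r) - 1))^n dv from 1
to exp L. Binomial expansion gives monomials Z^(n-l) v^(r(k+l-n)); their primitives take the values
exp(L) Z^k and Z^(n-l) at the endpoints, up to the common denominator. Parametrizing by L avoids
choosing a branch of Z^(1/r). -/
theorem padeIntegral_eq_sum {r : ℕ} (hr : 2 ≤ r) (n : ℕ) (L : ℂ) :
    padeIntegral r n L = ∑ l ∈ Finset.range (n + 1), ∑ k ∈ Finset.range (n + 1),
      (((-1) ^ (n + k + l) * (n.choose k * n.choose l) / (r * ((k : ℝ) + l - n) + 1) : ℝ) : ℂ) *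
      (Complex.exp L * Complex.exp (r * L) ^ k - Complex.exp (r * L) ^ (n - l)) := by
  by_cases hL : L = 0
  · subst hL
    simp [padeIntegral]
  have hc : ∀ k l : ℕ, ((r * ((k : ℝ) + l - n) + 1 : ℝ) : ℂ) ≠ 0 := by
    intro k l
    have := natCast_mul_intCast_add_one_ne_zero hr (k + l - n)
    push_cast at this
    exact_mod_cast this
  have h1 : ∀ s : ℝ, L * (Complex.exp (s * L) *
      ((Complex.exp (r * s * L) - 1) * (Complex.exp (r * (1 - s) * L) - 1)) ^ n) =
      ∑ l ∈ Finset.range (n + 1), ∑ k ∈ Finset.range (n + 1),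
        (((-1) ^ (n + k + l) * (n.choose k * n.choose l) : ℝ) : ℂ) * L *
        Complex.exp (r * L) ^ (n - l) *
        Complex.exp ((((r * ((k : ℝ) + l - n) + 1 : ℝ) : ℂ) * L) * s) := by
    intro s
    rw [mul_pow, sub_eq_add_neg, add_pow, sub_eq_add_neg, add_comm (Complex.exp (r * (1 - s) * L)),
      add_pow, Finset.sum_mul_sum, Finset.sum_comm, Finset.mul_sum, Finset.mul_sum]
    refine Finset.sum_congr rfl fun l hl => ?_
    rw [Finset.mul_sum, Finset.mul_sum]
    refine Finset.sum_congr rfl fun k hk => ?_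
    have hl : l ≤ n := by simpa [Nat.lt_succ_iff] using hl
    have hk : k ≤ n := by simpa [Nat.lt_succ_iff] using hk
    have hs : (-1 : ℂ) ^ (n - k) = (-1) ^ (n + k) := by
      have : n + k = (n - k) + 2 * k := by omega
      rw [this, pow_add, pow_mul]; simp
    rw [hs, ← Complex.exp_nat_mul, ← Complex.exp_nat_mul, ← Complex.exp_nat_mul]
    have he : Complex.exp (((n - l : ℕ) : ℂ) * (r * L)) *
        Complex.exp ((((r * ((k : ℝ) + l - n) + 1 : ℝ) : ℂ) * L) * s) =
        Complex.exp (s * L) * (Complex.exp (k * (r * s * L)) *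
          Complex.exp (((n - l : ℕ) : ℂ) * (r * (1 - s) * L))) := by
      rw [← Complex.exp_add, ← Complex.exp_add, ← Complex.exp_add, Nat.cast_sub hl]
      congr 1
      push_cast
      ring
    push_cast at he ⊢
    rw [pow_add _ _ l]
    linear_combination (-((-1 : ℂ) ^ (n + k) * (-1) ^ l * (n.choose k * n.choose l) * L)) * he
  unfold padeIntegral
  simp only [h1]
  rw [intervalIntegral.integral_finsetSum
    (fun l _ => Continuous.intervalIntegrable (by fun_prop) _ _)]
  refine Finset.sum_congr rfl fun l hl => ?_
  rw [intervalIntegral.integral_finsetSum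
    (fun k _ => Continuous.intervalIntegrable (by fun_prop) _ _)]
  refine Finset.sum_congr rfl fun k hk => ?_
  have hl : l ≤ n := by simpa [Nat.lt_succ_iff] using hl
  rw [intervalIntegral.integral_const_mul, integral_exp_mul_complex (mul_ne_zero (hc k l) hL)]
  have he : Complex.exp (r * L) ^ (n - l) *
      Complex.exp ((((r * ((k : ℝ) + l - n) + 1 : ℝ) : ℂ) * L)) =
      Complex.exp L * Complex.exp (r * L) ^ k := by
    rw [← Complex.exp_nat_mul, ← Complex.exp_nat_mul, ← Complex.exp_add, ← Complex.exp_add,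
      Nat.cast_sub hl]
    congr 1
    push_cast
    ring
  rw [← he]
  simp only [Complex.ofReal_one, mul_one, Complex.ofReal_zero, mul_zero, Complex.exp_zero]
  rw [Complex.ofReal_div]
  have := hc k l
  field_simp

/-- Numerator of the Padé approximation, as a polynomial in `Z = 1 - z`. -/
def padeA (r n : ℕ) : Polynomial ℂ :=
  ∑ l ∈ Finset.range (n + 1), Polynomial.C (padeCoeff r n l : ℂ) * Polynomial.X ^ (n - l)

/-- Denominator of the Padé approximation, as a polynomial in `Z = 1 - z`. -/
def padeB (r n : ℕ) : Polynomial ℂ :=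
  ∑ l ∈ Finset.range (n + 1), Polynomial.C (padeCoeff r n l : ℂ) * Polynomial.X ^ l

theorem padeA_eval (r n : ℕ) (Z : ℂ) : (padeA r n).eval Z =
    ∑ l ∈ Finset.range (n + 1), (padeCoeff r n l : ℂ) * Z ^ (n - l) := by
  simp [padeA, Polynomial.eval_finsetSum]

theorem padeB_eval (r n : ℕ) (Z : ℂ) : (padeB r n).eval Z =
    ∑ l ∈ Finset.range (n + 1), (padeCoeff r n l : ℂ) * Z ^ l := by
  simp [padeB, Polynomial.eval_finsetSum]

/-- The double sum for the integral has coefficients symmetric in k and l. Summing over l at the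
upper endpoint and over k at the lower one therefore produces the same numbers, which are the
coefficients of `padeB` and `padeA` in opposite orders. -/
theorem pade_remainder {r : ℕ} (hr : 2 ≤ r) (n : ℕ) (L : ℂ) :
    Complex.exp L * (padeB r n).eval (Complex.exp (r * L)) - (padeA r n).eval (Complex.exp (r * L))
      = padeNorm r n * padeIntegral r n L := by
  rw [padeIntegral_eq_sum hr, padeA_eval, padeB_eval]
  simp only [mul_sub, Finset.sum_sub_distrib, Finset.mul_sum]
  congr 1
  · rw [Finset.sum_comm]
    refine Finset.sum_congr rfl fun l hl => ?_
    have hl : l ≤ n := by simpa [Nat.lt_succ_iff] using hl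
    rw [← padeCoeff_eq_sum hr hl]
    push_cast
    rw [Finset.mul_sum, Finset.sum_mul, Finset.mul_sum]
    refine Finset.sum_congr rfl fun k _ => ?_
    rw [show n + k + l = n + l + k by ring, show (k : ℂ) + l - n = l + k - n by ring]
    ring
  · refine Finset.sum_congr rfl fun l hl => ?_
    have hl : l ≤ n := by simpa [Nat.lt_succ_iff] using hl
    rw [← padeCoeff_eq_sum hr hl]
    push_cast
    rw [Finset.mul_sum, Finset.sum_mul]
    refine Finset.sum_congr rfl fun k _ => ?_
    ring

/-- Each of the two factors under the n-th power has the form exp w - 1 with |w| ≤ r|L| ≤ 1, hence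
is at most 2r|L|. This is the order of vanishing 2n + 1 at L = 0. -/
theorem norm_padeIntegral_le (r n : ℕ) (hr : 1 ≤ r) (L : ℂ) (hL : r * ‖L‖ ≤ 1) :
    ‖padeIntegral r n L‖ ≤ 3 * ‖L‖ * (4 * (r * ‖L‖) ^ 2) ^ n := by
  have hr' : (1 : ℝ) ≤ r := by exact_mod_cast hr
  have hL1 : ‖L‖ ≤ 1 := by nlinarith [norm_nonneg L]
  have := intervalIntegral.norm_integral_le_of_norm_le_const (a := 0) (b := 1)
    (f := fun s : ℝ => L * (Complex.exp (s * L) *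
      ((Complex.exp (r * s * L) - 1) * (Complex.exp (r * (1 - s) * L) - 1)) ^ n))
    (C := 3 * ‖L‖ * (4 * (r * ‖L‖) ^ 2) ^ n) ?_
  · simpa [padeIntegral] using this
  intro s hs
  rw [Set.uIoc_of_le zero_le_one] at hs
  have hs0 : 0 ≤ s := hs.1.le
  have hs1 : s ≤ 1 := hs.2
  have key : ∀ t : ℝ, 0 ≤ t → t ≤ 1 → ‖(r : ℂ) * t * L‖ ≤ r * ‖L‖ := by
    intro t ht0 ht1
    rw [norm_mul, norm_mul, Complex.norm_natCast, Complex.norm_real, Real.norm_of_nonneg ht0]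
    have : 0 ≤ (r : ℝ) * ‖L‖ := by positivity
    nlinarith
  have e1 : ‖Complex.exp (r * s * L) - 1‖ ≤ 2 * (r * ‖L‖) := by
    have h := key s hs0 hs1
    exact (Complex.norm_exp_sub_one_le (h.trans hL)).trans (by linarith)
  have e2 : ‖Complex.exp (r * (1 - s) * L) - 1‖ ≤ 2 * (r * ‖L‖) := by
    have h := key (1 - s) (by linarith) (by linarith)
    push_cast at h
    exact (Complex.norm_exp_sub_one_le (h.trans hL)).trans (by linarith)
  have e3 : ‖Complex.exp (s * L)‖ ≤ 3 := by
    rw [Complex.norm_exp]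
    have h1 : ((s : ℂ) * L).re ≤ 1 := by
      refine (Complex.re_le_norm _).trans ?_
      rw [norm_mul, Complex.norm_real, Real.norm_of_nonneg hs0]
      nlinarith [norm_nonneg L]
    refine (Real.exp_le_exp.2 h1).trans ?_
    linarith [Real.exp_one_lt_d9]
  rw [norm_mul, norm_mul, norm_pow, norm_mul]
  calc ‖L‖ * (‖Complex.exp (s * L)‖ *
        (‖Complex.exp (r * s * L) - 1‖ * ‖Complex.exp (r * (1 - s) * L) - 1‖) ^ n)
      ≤ ‖L‖ * (3 * ((2 * (r * ‖L‖)) * (2 * (r * ‖L‖))) ^ n) := by gcongr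
    _ = _ := by ring

/-! ### Independence of consecutive Padé approximations -/

theorem X_sub_C_pow_dvd_of_isBigO (p : Polynomial ℂ) (a : ℂ) (m : ℕ)
    (h : (fun Z => p.eval Z) =O[nhds a] fun Z => (Z - a) ^ m) :
    (Polynomial.X - Polynomial.C a) ^ m ∣ p := by
  by_cases hp : p = 0
  · simp [hp]
  rw [← Polynomial.le_rootMultiplicity_iff hp]
  by_contra hlt
  push Not at hlt
  -- If the multiplicity k of the root a were below m, dividing the growth bound by |Z - a|^k and
  -- letting Z tend to a would give q(a) = 0.
  obtain ⟨q, hq, hnd⟩ := Polynomial.exists_eq_pow_rootMultiplicity_mul_and_not_dvd p hp a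
  set k := p.rootMultiplicity a
  have hqa : q.eval a ≠ 0 := fun h0 => hnd (Polynomial.dvd_iff_isRoot.2 h0)
  obtain ⟨c, hc⟩ := h.bound
  have hcont : Filter.Tendsto (fun Z => ‖q.eval Z‖ - c * ‖Z - a‖ ^ (m - k)) (nhdsWithin a {a}ᶜ)
      (nhds (‖q.eval a‖ - c * ‖a - a‖ ^ (m - k))) := by
    have : Continuous fun Z => ‖q.eval Z‖ - c * ‖Z - a‖ ^ (m - k) := by fun_prop
    exact (this.tendsto a).mono_left nhdsWithin_le_nhds
  have hle : ‖q.eval a‖ - c * ‖a - a‖ ^ (m - k) ≤ 0 := by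
    refine le_of_tendsto hcont ?_
    filter_upwards [nhdsWithin_le_nhds hc, self_mem_nhdsWithin] with Z hZ hne
    have hne : Z - a ≠ 0 := sub_ne_zero.2 hne
    have hpos : 0 < ‖Z - a‖ ^ k := pow_pos (norm_pos_iff.2 hne) _
    rw [hq] at hZ
    simp only [Polynomial.eval_mul, Polynomial.eval_pow, Polynomial.eval_sub, Polynomial.eval_X,
      Polynomial.eval_C, norm_mul, norm_pow] at hZ
    have e : ‖Z - a‖ ^ m = ‖Z - a‖ ^ k * ‖Z - a‖ ^ (m - k) := by
      rw [← pow_add, Nat.add_sub_cancel' hlt.le]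
    rw [e] at hZ
    have : ‖Z - a‖ ^ k * (‖q.eval Z‖ - c * ‖Z - a‖ ^ (m - k)) ≤ 0 := by linarith
    exact nonpos_of_mul_nonpos_right this hpos
  rw [sub_self, norm_zero, zero_pow (by omega), mul_zero, sub_zero] at hle
  exact hqa (norm_le_zero_iff.1 hle)

/-- Determinant of two consecutive Padé approximations. -/
def padeDet (r n : ℕ) : Polynomial ℂ :=
  padeA r n * padeB r (n + 1) - padeA r (n + 1) * padeB r n

theorem natDegree_padeA_le (r n : ℕ) : (padeA r n).natDegree ≤ n :=
  Polynomial.natDegree_sum_le_of_forall_le _ _ fun _ _ =>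
    (Polynomial.natDegree_C_mul_X_pow_le _ _).trans (Nat.sub_le _ _)

theorem natDegree_padeB_le (r n : ℕ) : (padeB r n).natDegree ≤ n :=
  Polynomial.natDegree_sum_le_of_forall_le _ _ fun l hl =>
    (Polynomial.natDegree_C_mul_X_pow_le _ _).trans (by simpa [Nat.lt_succ_iff] using hl)

theorem natDegree_padeDet_le (r n : ℕ) : (padeDet r n).natDegree ≤ 2 * n + 1 := by
  have h1 := natDegree_padeA_le r n
  have h2 := natDegree_padeB_le r n
  have h3 := natDegree_padeA_le r (n + 1)
  have h4 := natDegree_padeB_le r (n + 1)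
  refine (Polynomial.natDegree_sub_le _ _).trans (max_le ?_ ?_)
  · exact Polynomial.natDegree_mul_le.trans (by omega)
  · exact Polynomial.natDegree_mul_le.trans (by omega)

theorem padeCoeff_zero {r : ℕ} (hr : 2 ≤ r) (n : ℕ) :
    padeCoeff r n 0 = (r : ℝ) ^ n * prodPlus r n / n.factorial := by
  have := (prodMinus_pos hr n).ne'
  simp only [padeCoeff, padeNorm, Nat.choose_zero_right, Nat.sub_zero]
  rw [show prodPlus r 0 = 1 from Finset.prod_range_zero _]
  push_cast
  field_simp

theorem padeCoeff_self {r : ℕ} (n : ℕ) :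
    padeCoeff r n n = (r : ℝ) ^ n * prodMinus r n / n.factorial := by
  have := (prodPlus_pos r n).ne'
  simp only [padeCoeff, padeNorm, Nat.choose_self, Nat.sub_self]
  rw [show prodMinus r 0 = 1 from Finset.prod_range_zero _]
  push_cast
  field_simp

theorem padeA_eval_zero (r n : ℕ) : (padeA r n).eval 0 = (padeCoeff r n n : ℂ) := by
  rw [padeA_eval, Finset.sum_range_succ, Finset.sum_eq_zero]
  · simp
  · intro l hl
    have hl : l < n := by simpa using hl
    rw [zero_pow (by omega), mul_zero]

theorem padeB_eval_zero (r n : ℕ) : (padeB r n).eval 0 = (padeCoeff r n 0 : ℂ) := by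
  rw [padeB_eval, Finset.sum_range_succ', Finset.sum_eq_zero]
  · simp
  · intro l _
    rw [zero_pow (by omega), mul_zero]

/-- Only the constant terms survive. The two products differ just in the last factors r(n+1) + 1 and
r(n+1) - 1, so the difference is twice a positive number. -/
theorem padeDet_eval_zero_ne {r : ℕ} (hr : 2 ≤ r) (n : ℕ) : (padeDet r n).eval 0 ≠ 0 := by
  rw [padeDet, Polynomial.eval_sub, Polynomial.eval_mul, Polynomial.eval_mul, padeA_eval_zero,
    padeA_eval_zero, padeB_eval_zero, padeB_eval_zero, padeCoeff_zero hr, padeCoeff_zero hr,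
    padeCoeff_self, padeCoeff_self,
    show prodPlus r (n + 1) = prodPlus r n * (r * (n + 1) + 1) from Finset.prod_range_succ _ _,
    show prodMinus r (n + 1) = prodMinus r n * (r * (n + 1) - 1) from Finset.prod_range_succ _ _]
  have h1 := (prodPlus_pos r n).ne'
  have h2 := (prodMinus_pos hr n).ne'
  have h3 : (n.factorial : ℝ) ≠ 0 := by positivity
  have h4 : (r : ℝ) ≠ 0 := by positivity
  have h5 : ((n : ℝ) + 1) ≠ 0 := by positivity
  have h6 : (r : ℝ) ^ n * prodMinus r n / n.factorial *
      ((r : ℝ) ^ (n + 1) * (prodPlus r n * (r * (n + 1) + 1)) / (n + 1).factorial) -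
      (r : ℝ) ^ (n + 1) * (prodMinus r n * (r * (n + 1) - 1)) / (n + 1).factorial *
      ((r : ℝ) ^ n * prodPlus r n / n.factorial) ≠ 0 := by
    rw [Nat.factorial_succ]
    push_cast
    have : (r : ℝ) ^ n * prodMinus r n / n.factorial *
      ((r : ℝ) ^ (n + 1) * (prodPlus r n * (r * (n + 1) + 1)) / ((n + 1) * n.factorial)) -
      (r : ℝ) ^ (n + 1) * (prodMinus r n * (r * (n + 1) - 1)) / ((n + 1) * n.factorial) *
      ((r : ℝ) ^ n * prodPlus r n / n.factorial) =
      2 * ((r : ℝ) ^ n * prodMinus r n / n.factorial *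
      ((r : ℝ) ^ (n + 1) * prodPlus r n / ((n + 1) * n.factorial))) := by
      field_simp
      ring
    rw [this]
    positivity
  exact_mod_cast h6

/-- With exp L = Z^(1/r) and R_n the remainder exp(L) B_n - A_n, eliminating B gives A_n B_(n+1) -
A_(n+1) B_n = exp(-L) (A_n R_(n+1) - A_(n+1) R_n), and each R_m is of order (Z - 1)^(2m+1). -/
theorem padeDet_isBigO {r : ℕ} (hr : 2 ≤ r) (n : ℕ) :
    (fun Z => (padeDet r n).eval Z) =O[nhds 1] fun Z => (Z - 1) ^ (2 * n + 1) := by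
  have hr0 : (r : ℂ) ≠ 0 := by
    have : r ≠ 0 := by omega
    exact_mod_cast this
  have hlog : ContinuousAt (fun Z : ℂ => Complex.log Z / r) 1 :=
    (continuousAt_clog (by simp)).div_const _
  have hL : (fun Z : ℂ => Complex.log Z / r) =O[nhds 1] fun Z => Z - 1 := by
    have h := (Complex.hasDerivAt_log (z := 1) (by simp)).isBigO_sub
    simp only [Complex.log_one, sub_zero] at h
    simpa [div_eq_inv_mul] using h.const_mul_left (r : ℂ)⁻¹
  have hsmall : ∀ᶠ Z : ℂ in nhds 1, r * ‖Complex.log Z / r‖ ≤ 1 := by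
    have h1 : ContinuousAt (fun Z : ℂ => r * ‖Complex.log Z / r‖) 1 :=
      continuousAt_const.mul hlog.norm
    refine h1.eventually_le_const ?_
    simp
  have hI : ∀ m : ℕ, (fun Z : ℂ => padeIntegral r m (Complex.log Z / r)) =O[nhds 1]
      fun Z => (Z - 1) ^ (2 * m + 1) := by
    intro m
    refine Asymptotics.IsBigO.trans ?_ (hL.pow (2 * m + 1))
    refine Asymptotics.IsBigO.of_bound (3 * (4 * (r : ℝ) ^ 2) ^ m) ?_
    filter_upwards [hsmall] with Z hZ
    refine (norm_padeIntegral_le r m (by omega) _ hZ).trans (le_of_eq ?_)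
    rw [norm_pow]
    ring
  have hI' : (fun Z : ℂ => padeIntegral r (n + 1) (Complex.log Z / r)) =O[nhds 1]
      fun Z => (Z - 1) ^ (2 * n + 1) := by
    refine (hI (n + 1)).trans ?_
    have e : (fun Z : ℂ => (Z - 1) ^ (2 * (n + 1) + 1)) =
        fun Z : ℂ => (Z - 1) ^ 2 * (Z - 1) ^ (2 * n + 1) := by
      funext Z; rw [← pow_add]; congr 1; ring
    rw [e]
    have h1 : (fun Z : ℂ => (Z - 1) ^ 2) =O[nhds 1] fun _ => (1 : ℂ) :=
      (show Continuous fun Z : ℂ => (Z - 1) ^ 2 by fun_prop).continuousAt.isBigO_one ℂ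
    simpa using h1.mul (Asymptotics.isBigO_refl (fun Z : ℂ => (Z - 1) ^ (2 * n + 1)) (nhds 1))
  have hA : ∀ p : Polynomial ℂ, (fun Z => p.eval Z) =O[nhds (1 : ℂ)] fun _ => (1 : ℂ) :=
    fun p => p.continuous.continuousAt.isBigO_one ℂ
  have hexp : (fun Z : ℂ => Complex.exp (-(Complex.log Z / r))) =O[nhds 1] fun _ => (1 : ℂ) :=
    (hlog.neg.cexp).isBigO_one ℂ
  have hmain : (fun Z : ℂ => Complex.exp (-(Complex.log Z / r)) *
      ((padeNorm r (n + 1) : ℂ) * ((padeA r n).eval Z * padeIntegral r (n + 1) (Complex.log Z / r))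
      - (padeNorm r n : ℂ) * ((padeA r (n + 1)).eval Z * padeIntegral r n (Complex.log Z / r))))
      =O[nhds 1] fun Z => (Z - 1) ^ (2 * n + 1) := by
    have h1 := ((hA (padeA r n)).mul hI').const_mul_left (padeNorm r (n + 1) : ℂ)
    have h2 := ((hA (padeA r (n + 1))).mul (hI n)).const_mul_left (padeNorm r n : ℂ)
    have := hexp.mul (h1.sub h2)
    simpa using this
  refine hmain.congr' ?_ Filter.EventuallyEq.rfl
  have hne : ∀ᶠ Z : ℂ in nhds 1, Z ≠ 0 := eventually_ne_nhds one_ne_zero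
  filter_upwards [hne] with Z hZ
  have hexpL : Complex.exp (r * (Complex.log Z / r)) = Z := by
    rw [mul_div_cancel₀ _ hr0, Complex.exp_log hZ]
  have h1 := pade_remainder hr n (Complex.log Z / r)
  have h2 := pade_remainder hr (n + 1) (Complex.log Z / r)
  rw [hexpL] at h1 h2
  rw [padeDet, Polynomial.eval_sub, Polynomial.eval_mul, Polynomial.eval_mul]
  have h3 : Complex.exp (-(Complex.log Z / r)) * Complex.exp (Complex.log Z / r) = 1 := by
    rw [← Complex.exp_add]; simp
  linear_combination Complex.exp (-(Complex.log Z / r)) * ((padeA r (n + 1)).eval Z * h1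
    - (padeA r n).eval Z * h2) + ((padeA r n).eval Z * (padeB r (n + 1)).eval Z
    - (padeA r (n + 1)).eval Z * (padeB r n).eval Z) * h3

/-- The degree is at most 2n + 1 and (Z - 1)^(2n+1) divides the determinant, so it is a constant
multiple of that power; the value at 0 shows that the constant is nonzero. -/
theorem padeDet_eval_ne_zero {r : ℕ} (hr : 2 ≤ r) (n : ℕ) {Z : ℂ} (hZ : Z ≠ 1) :
    (padeDet r n).eval Z ≠ 0 := by
  obtain ⟨q, hq⟩ := X_sub_C_pow_dvd_of_isBigO _ 1 _ (padeDet_isBigO hr n)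
  have h0 := padeDet_eval_zero_ne hr n
  have hd0 : padeDet r n ≠ 0 := by
    intro h; rw [h] at h0; simp at h0
  have hq0 : q ≠ 0 := by
    rintro rfl; exact hd0 (by simpa using hq)
  have hdeg := natDegree_padeDet_le r n
  have hmon : ((Polynomial.X - Polynomial.C (1 : ℂ)) ^ (2 * n + 1)).Monic :=
    (Polynomial.monic_X_sub_C _).pow _
  rw [hq, hmon.natDegree_mul' hq0, Polynomial.natDegree_pow, Polynomial.natDegree_X_sub_C] at hdeg
  have hqd : q.natDegree = 0 := by omega
  obtain ⟨c, rfl⟩ := Polynomial.natDegree_eq_zero.1 hqd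
  have hc : c ≠ 0 := by rintro rfl; simp at hq0
  rw [hq]
  simp [sub_eq_zero, hZ, hc]

/-! ### Arithmetic of a diagonalization -/

theorem formEval_cast (F : MvPolynomial (Fin 2) ℤ) (x y : ℤ) :
    (formEval F x y : ℂ) =
      MvPolynomial.eval ![(x : ℂ), (y : ℂ)] (MvPolynomial.map (Int.castRingHom ℂ) F) := by
  unfold formEval
  induction F using MvPolynomial.induction_on with
  | C a => simp
  | add p q hp hq => simp only [map_add, Int.cast_add, hp, hq]
  | mul_X p i hp =>
    simp only [map_mul, Int.cast_mul, hp, map_X, eval_X]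
    congr 1
    fin_cases i <;> simp

theorem formEvalReal_cast (F : MvPolynomial (Fin 2) ℤ) (x y : ℝ) :
    (formEvalReal F x y : ℂ) =
      MvPolynomial.eval ![(x : ℂ), (y : ℂ)] (MvPolynomial.map (Int.castRingHom ℂ) F) := by
  unfold formEvalReal
  induction F using MvPolynomial.induction_on with
  | C a => simp
  | add p q hp hq => simp only [map_add, Complex.ofReal_add, hp, hq]
  | mul_X p i hp =>
    simp only [map_mul, Complex.ofReal_mul, hp, map_X, eval_X, aeval_X]
    congr 1
    fin_cases i <;> simp

theorem eval_linForm (a b x y : ℂ) : MvPolynomial.eval ![x, y] (linForm a b) = a * x + b * y := by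
  simp [linForm]

/-- A diagonalization of `F` with a primitive integral quadratic form `a x² + b x y + c y²`
proportional to the product of the two linear forms, with factor `χ`, and a square root `s` of
its discriminant. -/
structure DiagonalData (r : ℕ) (F : MvPolynomial (Fin 2) ℤ) where
  (α β γ δ χ s : ℂ)
  (a b c : ℤ)
  diag : IsDiagonalization r F α β γ δ
  coeff_xx : α * γ = χ * a
  coeff_xy : α * δ + β * γ = χ * b
  coeff_yy : β * δ = χ * c
  det : α * δ - β * γ = χ * s
  primitive : ∃ u v w : ℤ, u * a + v * b + w * c = 1

/-- The gcd g of the coefficients is moved into χ, which makes the quadratic form primitive. The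
discriminant changes by g² only, so its sign is kept. -/
theorem IsAssociatedD.exists_diagonalData {r : ℕ} {F : MvPolynomial (Fin 2) ℤ} {D : ℤ}
    (h : IsAssociatedD r F D) :
    ∃ (d : DiagonalData r F) (g : ℤ), g ≠ 0 ∧ D = g ^ 2 * (d.b ^ 2 - 4 * d.a * d.c) := by
  obtain ⟨α, β, γ, δ, χ, a, b, c, hd, hq, rfl⟩ := h
  have e : ∀ x y : ℂ, (α * x + β * y) * (γ * x + δ * y) =
      χ * (a * x ^ 2 + b * (x * y) + c * y ^ 2) := by
    intro x y
    have := congrArg (MvPolynomial.eval ![x, y]) hq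
    simpa [eval_linForm] using this
  have h1 : α * γ = χ * a := by simpa using e 1 0
  have h3 : β * δ = χ * c := by simpa using e 0 1
  have h2 : α * δ + β * γ = χ * b := by
    have := e 1 1
    linear_combination this - h1 - h3
  have hdet := hd.det_ne_zero
  have hχ : χ ≠ 0 := by
    rintro rfl
    apply pow_ne_zero 2 hdet
    linear_combination (α * δ + β * γ) * h2 - 4 * β * δ * h1
  obtain ⟨k, hk⟩ := (IsPrincipalIdealRing.principal (Ideal.span {a, b, c} : Ideal ℤ))
  have hk : (Ideal.span {a, b, c} : Ideal ℤ) = Ideal.span {k} := hk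
  have ha : a ∈ (Ideal.span {a, b, c} : Ideal ℤ) := Ideal.subset_span (by simp)
  have hb : b ∈ (Ideal.span {a, b, c} : Ideal ℤ) := Ideal.subset_span (by simp)
  have hc : c ∈ (Ideal.span {a, b, c} : Ideal ℤ) := Ideal.subset_span (by simp)
  have hkm : k ∈ (Ideal.span {a, b, c} : Ideal ℤ) := by
    rw [hk]; exact Ideal.mem_span_singleton_self k
  rw [hk, Ideal.mem_span_singleton] at ha hb hc
  obtain ⟨a', ha'⟩ := ha
  obtain ⟨b', hb'⟩ := hb
  obtain ⟨c', hc'⟩ := hc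
  have hk0 : k ≠ 0 := by
    rintro rfl
    apply pow_ne_zero 2 hdet
    rw [ha'] at h1
    rw [hb'] at h2
    push_cast at h1 h2
    linear_combination (α * δ + β * γ) * h2 - 4 * β * δ * h1
  simp only [Ideal.mem_span_insert, Ideal.mem_span_singleton'] at hkm
  obtain ⟨u, z, ⟨v, z', ⟨w, rfl⟩, rfl⟩, huvw⟩ := hkm
  refine ⟨⟨α, β, γ, δ, χ * k, (α * δ - β * γ) / (χ * k), a', b', c', hd, ?_, ?_, ?_, ?_, ?_⟩,
    k, hk0, ?_⟩
  · rw [h1, ha']; push_cast; ring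
  · rw [h2, hb']; push_cast; ring
  · rw [h3, hc']; push_cast; ring
  · have : (k : ℂ) ≠ 0 := by exact_mod_cast hk0
    field_simp
  · refine ⟨u, v, w, mul_left_cancel₀ hk0 ?_⟩
    linear_combination (-u) * ha' - v * hb' - w * hc' - huvw
  · change b ^ 2 - 4 * a * c = k ^ 2 * (b' ^ 2 - 4 * a' * c')
    rw [ha', hb', hc']; ring

namespace DiagonalData

variable {r : ℕ} {F : MvPolynomial (Fin 2) ℤ} (d : DiagonalData r F)

/-- The first linear form. -/
def xi (p : ℤ × ℤ) : ℂ := d.α * p.1 + d.β * p.2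

/-- The second linear form. -/
def eta (p : ℤ × ℤ) : ℂ := d.γ * p.1 + d.δ * p.2

theorem χ_ne_zero : d.χ ≠ 0 := by
  intro h
  have := d.det
  rw [h, zero_mul] at this
  exact d.diag.det_ne_zero this

theorem s_ne_zero : d.s ≠ 0 := by
  intro h
  have := d.det
  rw [h, mul_zero] at this
  exact d.diag.det_ne_zero this

/-- χ²s² = (αδ - βγ)² = (αδ + βγ)² - 4αβγδ, which is χ² times the discriminant of the quadratic
form. -/
theorem s_sq : d.s ^ 2 = ((d.b ^ 2 - 4 * d.a * d.c : ℤ) : ℂ) := by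
  refine mul_left_cancel₀ (pow_ne_zero 2 d.χ_ne_zero) ?_
  push_cast
  linear_combination (-(d.α * d.δ - d.β * d.γ) - d.χ * d.s) * d.det
    + (d.α * d.δ + d.β * d.γ + d.χ * d.b) * d.coeff_xy
    - 4 * (d.β * d.δ) * d.coeff_xx - 4 * (d.χ * d.a) * d.coeff_yy

theorem one_le_norm_s : 1 ≤ ‖d.s‖ := by
  have h := congrArg norm d.s_sq
  rw [norm_pow, Complex.norm_intCast] at h
  have h0 : d.b ^ 2 - 4 * d.a * d.c ≠ 0 := by
    intro h0
    have := d.s_sq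
    rw [h0, Int.cast_zero] at this
    exact d.s_ne_zero (pow_eq_zero_iff two_ne_zero |>.1 this)
  have h1 : (1 : ℝ) ≤ |((d.b ^ 2 - 4 * d.a * d.c : ℤ) : ℝ)| := by
    exact_mod_cast Int.one_le_abs h0
  rw [← h] at h1
  by_contra hlt
  push Not at hlt
  nlinarith [norm_nonneg d.s]

theorem xi_pow_sub_eta_pow (p : ℤ × ℤ) :
    d.xi p ^ r - d.eta p ^ r = (formEval F p.1 p.2 : ℂ) := by
  rw [formEval_cast, d.diag.eq_sub, map_sub, map_pow, map_pow, eval_linForm, eval_linForm]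
  rfl

/-- The integer is the value at p of the Jacobian of F and the quadratic form. Together with F = ξ^r
- η^r this shows that 2rsξ^r and 2rsη^r are conjugate elements S ± Ts with S, T integers. -/
theorem exists_jacobian (hr : 1 ≤ r) (p : ℤ × ℤ) :
    ∃ m : ℤ, r * d.s * (d.xi p ^ r + d.eta p ^ r) = m := by
  refine ⟨formEval (pderiv 0 F) p.1 p.2 * (d.b * p.1 + 2 * d.c * p.2) -
    formEval (pderiv 1 F) p.1 p.2 * (2 * d.a * p.1 + d.b * p.2), ?_⟩
  refine mul_left_cancel₀ d.χ_ne_zero ?_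
  push_cast
  rw [formEval_cast, formEval_cast, d.diag.pderiv_zero, d.diag.pderiv_one]
  simp only [map_mul, map_sub, map_pow, eval_linForm, eval_C]
  obtain ⟨n, rfl⟩ : ∃ n, r = n + 1 := ⟨r - 1, by omega⟩
  rw [Nat.add_sub_cancel, xi, eta]
  set x : ℂ := d.α * p.1 + d.β * p.2 with hx
  set y : ℂ := d.γ * p.1 + d.δ * p.2 with hy
  have h1 : d.χ * (d.b * p.1 + 2 * d.c * p.2) = d.β * y + d.δ * x := by
    rw [hx, hy]; linear_combination (-(p.1 : ℂ)) * d.coeff_xy - 2 * p.2 * d.coeff_yy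
  have h2 : d.χ * (2 * d.a * p.1 + d.b * p.2) = d.α * y + d.γ * x := by
    rw [hx, hy]; linear_combination (-(p.2 : ℂ)) * d.coeff_xy - 2 * p.1 * d.coeff_xx
  rw [pow_succ x, pow_succ y]
  linear_combination (-((n + 1 : ℕ) : ℂ)) * (x ^ n * x + y ^ n * y) * d.det
    - ((n + 1 : ℕ) : ℂ) * (d.α * x ^ n - d.γ * y ^ n) * h1
    + ((n + 1 : ℕ) : ℂ) * (d.β * x ^ n - d.δ * y ^ n) * h2

/-- Together with `xi_mul_eta_add` this shows that 2ξ(p)η(q) and 2ξ(q)η(p) are χ times the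
conjugates P ± ks with P, k integers. -/
theorem xi_mul_eta_sub (p q : ℤ × ℤ) :
    d.xi p * d.eta q - d.xi q * d.eta p = d.χ * d.s * ((p.1 * q.2 - q.1 * p.2 : ℤ) : ℂ) := by
  rw [← d.det, xi, xi, eta, eta]; push_cast; ring

theorem xi_mul_eta_add (p q : ℤ × ℤ) :
    d.xi p * d.eta q + d.xi q * d.eta p = d.χ *
      ((2 * d.a * p.1 * q.1 + d.b * (p.1 * q.2 + q.1 * p.2) + 2 * d.c * p.2 * q.2 : ℤ) : ℂ) := by
  rw [xi, xi, eta, eta]; push_cast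
  linear_combination (2 * (p.1 : ℂ) * q.1) * d.coeff_xx +
    ((p.1 : ℂ) * q.2 + q.1 * p.2) * d.coeff_xy + (2 * (p.2 : ℂ) * q.2) * d.coeff_yy

/-- `4 r² s² χ ^ r` is an integer. -/
theorem exists_int_eq (hr : 1 ≤ r) : ∃ m : ℤ, 4 * r ^ 2 * d.s ^ 2 * d.χ ^ r = m := by
  let κ : ℂ := 4 * r ^ 2 * d.s ^ 2 * d.χ ^ r
  let I : Ideal ℤ :=
    { carrier := {n | ∃ m : ℤ, κ * n = m}
      zero_mem' := ⟨0, by simp⟩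
      add_mem' := by
        rintro x y ⟨m, hm⟩ ⟨n, hn⟩
        exact ⟨m + n, by push_cast; rw [mul_add, hm, hn]⟩
      smul_mem' := by
        rintro x y ⟨m, hm⟩
        exact ⟨x * m, by push_cast; rw [smul_eq_mul, ← hm]; push_cast; ring⟩ }
  -- Let Q be the quadratic form. Then 4r²s²χ^r Q^r = 4r²s²(ξη)^r is the difference of the squares
  -- of rs(ξ^r + η^r) and rs(ξ^r - η^r), hence an integer. The values of Q at (1,0), (1,1), (0,1)
  -- generate the unit ideal, and so do their r-th powers.
  have hI : ∀ x y : ℤ, (d.a * x ^ 2 + d.b * (x * y) + d.c * y ^ 2) ^ r ∈ I := by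
    intro x y
    obtain ⟨m, hm⟩ := d.exists_jacobian hr (x, y)
    have hf := d.xi_pow_sub_eta_pow (x, y)
    have hq : d.χ * (d.a * x ^ 2 + d.b * (x * y) + d.c * y ^ 2) = d.xi (x, y) * d.eta (x, y) := by
      rw [xi, eta]
      linear_combination (-(x : ℂ) ^ 2) * d.coeff_xx - ((x : ℂ) * y) * d.coeff_xy -
        ((y : ℂ) ^ 2) * d.coeff_yy
    refine ⟨m ^ 2 - r ^ 2 * (d.b ^ 2 - 4 * d.a * d.c) * formEval F x y ^ 2, ?_⟩
    have hs := d.s_sq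
    push_cast at hs ⊢
    rw [← hm, ← hs, ← hf]
    have hqr : d.χ ^ r * (d.a * x ^ 2 + d.b * (x * y) + d.c * y ^ 2) ^ r =
        d.xi (x, y) ^ r * d.eta (x, y) ^ r := by rw [← mul_pow, ← mul_pow, hq]
    linear_combination 4 * (r : ℂ) ^ 2 * d.s ^ 2 * hqr
  obtain ⟨u, v, w, huvw⟩ := d.primitive
  have hspan : Ideal.span {d.a, d.a + d.b + d.c, d.c} = ⊤ := by
    rw [Ideal.eq_top_iff_one]
    simp only [Ideal.mem_span_insert, Ideal.mem_span_singleton']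
    exact ⟨u - v, v * (d.a + d.b + d.c) + (w - v) * d.c, ⟨v, _, ⟨w - v, rfl⟩, rfl⟩,
      by linear_combination -huvw⟩
  have htop := Ideal.span_pow_eq_top _ hspan r
  have hle : Ideal.span ((fun x => x ^ r) '' {d.a, d.a + d.b + d.c, d.c}) ≤ I := by
    rw [Ideal.span_le]
    rintro _ ⟨t, ht, rfl⟩
    rcases ht with rfl | rfl | rfl
    · simpa using hI 1 0
    · simpa using hI 1 1
    · simpa using hI 0 1
  rw [htop] at hle
  obtain ⟨m, hm⟩ := hle (show (1 : ℤ) ∈ ⊤ from trivial)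
  exact ⟨m, by simpa [κ] using hm⟩

/-- A nonzero integer has absolute value at least 1, and |αδ - βγ| = |χ||s|. The bound controls the
denominators (2rs)^n of the Padé forms in terms of the determinant. -/
theorem norm_s_pow_le (hr : 2 ≤ r) :
    ‖d.s‖ ^ (r - 2) ≤ 4 * (r : ℝ) ^ 2 * ‖d.α * d.δ - d.β * d.γ‖ ^ r := by
  obtain ⟨m, hm⟩ := d.exists_int_eq (by omega)
  have hm0 : m ≠ 0 := by
    rintro rfl
    have hr0 : (r : ℂ) ≠ 0 := by exact_mod_cast (by omega : r ≠ 0)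
    have h0 : 4 * (r : ℂ) ^ 2 * d.s ^ 2 * d.χ ^ r ≠ 0 :=
      mul_ne_zero (mul_ne_zero (mul_ne_zero (by norm_num) (pow_ne_zero _ hr0)) (pow_ne_zero _ d.s_ne_zero))
        (pow_ne_zero _ d.χ_ne_zero)
    exact h0 (by simpa using hm)
  have h1 : (1 : ℝ) ≤ ‖(m : ℂ)‖ := by
    rw [Complex.norm_intCast]; exact_mod_cast Int.one_le_abs hm0
  rw [← hm] at h1
  simp only [norm_mul, norm_pow, Complex.norm_natCast, Complex.norm_ofNat] at h1
  rw [d.det, norm_mul, mul_pow]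
  have e : ‖d.s‖ ^ r = ‖d.s‖ ^ (r - 2) * ‖d.s‖ ^ 2 := by
    rw [← pow_add, Nat.sub_add_cancel hr]
  rw [e]
  have : 0 ≤ ‖d.s‖ ^ (r - 2) := by positivity
  nlinarith

end DiagonalData

/-! ### Integral forms from the Padé approximations -/

/-- The pairs `(S + T s, S - T s)` with `S`, `T` integers, where `s` is a square root of the
integer `D`. -/
def conjPairs (s : ℂ) (D : ℤ) (hs : s ^ 2 = D) : Subring (ℂ × ℂ) where
  carrier := {z | ∃ S T : ℤ, z.1 = S + T * s ∧ z.2 = S - T * s}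
  mul_mem' := by
    rintro x y ⟨S, T, h1, h2⟩ ⟨S', T', h3, h4⟩
    refine ⟨S * S' + T * T' * D, S * T' + S' * T, ?_, ?_⟩
    · rw [Prod.fst_mul, h1, h3]; push_cast; linear_combination (T : ℂ) * T' * hs
    · rw [Prod.snd_mul, h2, h4]; push_cast; linear_combination (T : ℂ) * T' * hs
  one_mem' := ⟨1, 0, by simp⟩
  add_mem' := by
    rintro x y ⟨S, T, h1, h2⟩ ⟨S', T', h3, h4⟩
    refine ⟨S + S', T + T', ?_, ?_⟩
    · rw [Prod.fst_add, h1, h3]; push_cast; ring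
    · rw [Prod.snd_add, h2, h4]; push_cast; ring
  zero_mem' := ⟨0, 0, by simp⟩
  neg_mem' := by
    rintro x ⟨S, T, h1, h2⟩
    refine ⟨-S, -T, ?_, ?_⟩
    · rw [Prod.fst_neg, h1]; push_cast; ring
    · rw [Prod.snd_neg, h2]; push_cast; ring

namespace DiagonalData

variable {r : ℕ} {F : MvPolynomial (Fin 2) ℤ} (d : DiagonalData r F)

/-- The linear form in `xi q`, `eta q` that comes from the Padé approximation at `p`. -/
def padeForm (n : ℕ) (p q : ℤ × ℤ) : ℂ :=
  d.xi q * d.eta p * ∑ l ∈ Finset.range (n + 1), (padeCoeff r n l : ℂ) *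
    ((d.xi p ^ r) ^ (n - l) * (d.eta p ^ r) ^ l) -
  d.xi p * d.eta q * ∑ l ∈ Finset.range (n + 1), (padeCoeff r n l : ℂ) *
    ((d.eta p ^ r) ^ (n - l) * (d.xi p ^ r) ^ l)

/-- After multiplication by (2rs)^n the two terms of the form are χ/2 times conjugate elements S ±
Ts, so their difference is χsT. The factor (2rs)^n turns all powers of ξ^r and η^r, of total degree
n, into elements of `conjPairs`. -/
theorem exists_int_padeForm (hr : 2 ≤ r) (n : ℕ) (p q : ℤ × ℤ) :
    ∃ T : ℤ, (2 * r * d.s) ^ n * d.padeForm n p q = d.χ * d.s * T := by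
  obtain ⟨m, hm⟩ := d.exists_jacobian (by omega) p
  have hf := d.xi_pow_sub_eta_pow p
  set μ := 2 * r * d.s * d.xi p ^ r with hμ
  set ν := 2 * r * d.s * d.eta p ^ r with hν
  let R := conjPairs d.s _ d.s_sq
  -- The elements are m ± rF(p)s, where m = rs(ξ^r + η^r).
  have h1 : ((μ, ν) : ℂ × ℂ) ∈ R :=
    ⟨m, r * formEval F p.1 p.2, by push_cast; rw [← hm, ← hf]; ring,
      by push_cast; rw [← hm, ← hf]; ring⟩
  have h2 : ((ν, μ) : ℂ × ℂ) ∈ R :=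
    ⟨m, -(r * formEval F p.1 p.2), by push_cast; rw [← hm, ← hf]; ring,
      by push_cast; rw [← hm, ← hf]; ring⟩
  have hc : ∀ l ∈ Finset.range (n + 1),
      (((padeCoeff r n l : ℂ), (padeCoeff r n l : ℂ)) : ℂ × ℂ) ∈ R := by
    intro l hl
    obtain ⟨c, hc⟩ := padeCoeff_int hr (n := n) (l := l) (by simpa [Nat.lt_succ_iff] using hl)
    exact ⟨c, 0, by simp [hc], by simp [hc]⟩
  have h3 := R.sum_mem fun l hl => R.mul_mem (hc l hl)
    (R.mul_mem (R.pow_mem h1 (n - l)) (R.pow_mem h2 l))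
  have hsub := d.xi_mul_eta_sub p q
  have hadd := d.xi_mul_eta_add p q
  set k : ℤ := p.1 * q.2 - q.1 * p.2
  set P : ℤ := 2 * d.a * p.1 * q.1 + d.b * (p.1 * q.2 + q.1 * p.2) + 2 * d.c * p.2 * q.2
  have h4 : ((P - k * d.s, P + k * d.s) : ℂ × ℂ) ∈ R :=
    ⟨P, -k, by push_cast; ring, by push_cast; ring⟩
  obtain ⟨S, T, hS, hT⟩ := R.mul_mem h4 h3
  simp only [Prod.fst_mul, Prod.snd_mul, Prod.fst_sum, Prod.snd_sum, Prod.pow_fst,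
    Prod.pow_snd] at hS hT
  refine ⟨T, ?_⟩
  have e1 : ∀ x y : ℂ, (2 * r * d.s) ^ n * ∑ l ∈ Finset.range (n + 1), (padeCoeff r n l : ℂ) *
      (x ^ (n - l) * y ^ l) = ∑ l ∈ Finset.range (n + 1), (padeCoeff r n l : ℂ) *
      ((2 * r * d.s * x) ^ (n - l) * (2 * r * d.s * y) ^ l) := by
    intro x y
    rw [Finset.mul_sum]
    refine Finset.sum_congr rfl fun l hl => ?_
    have hl : l ≤ n := by simpa [Nat.lt_succ_iff] using hl
    rw [mul_pow _ x, mul_pow _ y]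
    conv_lhs => rw [← Nat.sub_add_cancel hl, pow_add]
    rw [Nat.sub_add_cancel hl]
    ring
  have e2 := e1 (d.xi p ^ r) (d.eta p ^ r)
  have e3 := e1 (d.eta p ^ r) (d.xi p ^ r)
  rw [← hμ, ← hν] at e2 e3
  rw [← e2] at hS
  rw [← e3] at hT
  rw [padeForm]
  set A := ∑ l ∈ Finset.range (n + 1), (padeCoeff r n l : ℂ) *
    ((d.xi p ^ r) ^ (n - l) * (d.eta p ^ r) ^ l)
  set B := ∑ l ∈ Finset.range (n + 1), (padeCoeff r n l : ℂ) *
    ((d.eta p ^ r) ^ (n - l) * (d.xi p ^ r) ^ l)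
  linear_combination (1 / 2 : ℂ) * (2 * r * d.s) ^ n * ((A - B) * hadd - (A + B) * hsub)
    + (1 / 2 : ℂ) * d.χ * (hS - hT)

theorem norm_det_le_padeForm (hr : 2 ≤ r) (n : ℕ) (p q : ℤ × ℤ) (h : d.padeForm n p q ≠ 0) :
    ‖d.α * d.δ - d.β * d.γ‖ ≤ (2 * r * ‖d.s‖) ^ n * ‖d.padeForm n p q‖ := by
  obtain ⟨T, hT⟩ := d.exists_int_padeForm hr n p q
  have hr0 : (r : ℂ) ≠ 0 := by exact_mod_cast (by omega : r ≠ 0)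
  have hT0 : T ≠ 0 := by
    rintro rfl
    rw [Int.cast_zero, mul_zero] at hT
    exact mul_ne_zero (pow_ne_zero _ (mul_ne_zero (mul_ne_zero two_ne_zero hr0) d.s_ne_zero)) h hT
  have h1 : (1 : ℝ) ≤ ‖(T : ℂ)‖ := by
    rw [Complex.norm_intCast]; exact_mod_cast Int.one_le_abs hT0
  have h2 := congrArg norm hT
  simp only [norm_mul, norm_pow, Complex.norm_natCast, Complex.norm_ofNat] at h2
  rw [h2, d.det, norm_mul]
  exact le_mul_of_one_le_right (by positivity) h1

/-- Taking out the powers of ξ(p) leaves the Padé polynomials at Z = (η(p)/ξ(p))^r = exp(rL). The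
common root ω for p and q is what lets exp L and exp L' be compared. -/
theorem padeForm_eq (n : ℕ) (p q : ℤ × ℤ) (ω L L' : ℂ) (hω : ω ^ r = 1)
    (hp : d.eta p = ω * Complex.exp L * d.xi p) (hq : d.eta q = ω * Complex.exp L' * d.xi q) :
    d.padeForm n p q = d.xi q * d.xi p * ω * (d.xi p ^ r) ^ n *
      (Complex.exp L * (padeB r n).eval (Complex.exp (r * L)) -
        Complex.exp L' * (padeA r n).eval (Complex.exp (r * L))) := by
  have hpr : d.eta p ^ r = Complex.exp (r * L) * d.xi p ^ r := by
    rw [hp, mul_pow, mul_pow, hω, one_mul, ← Complex.exp_nat_mul]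
  rw [padeForm, hpr, padeA_eval, padeB_eval]
  set Z := Complex.exp (r * L)
  have e1 : ∑ l ∈ Finset.range (n + 1), (padeCoeff r n l : ℂ) *
      ((d.xi p ^ r) ^ (n - l) * (Z * d.xi p ^ r) ^ l) = (d.xi p ^ r) ^ n *
      ∑ l ∈ Finset.range (n + 1), (padeCoeff r n l : ℂ) * Z ^ l := by
    rw [Finset.mul_sum]
    refine Finset.sum_congr rfl fun l hl => ?_
    have hl : l ≤ n := by simpa [Nat.lt_succ_iff] using hl
    conv_rhs => rw [← Nat.sub_add_cancel hl, pow_add]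
    rw [Nat.sub_add_cancel hl]
    ring
  have e2 : ∑ l ∈ Finset.range (n + 1), (padeCoeff r n l : ℂ) *
      ((Z * d.xi p ^ r) ^ (n - l) * (d.xi p ^ r) ^ l) = (d.xi p ^ r) ^ n *
      ∑ l ∈ Finset.range (n + 1), (padeCoeff r n l : ℂ) * Z ^ (n - l) := by
    rw [Finset.mul_sum]
    refine Finset.sum_congr rfl fun l hl => ?_
    have hl : l ≤ n := by simpa [Nat.lt_succ_iff] using hl
    rw [mul_pow]
    conv_rhs => rw [← Nat.sub_add_cancel hl, pow_add]
    rw [Nat.sub_add_cancel hl]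
    ring
  rw [e1, e2, hp, hq]
  ring

/-- If both forms vanished, eliminating exp L' would make `padeDet` vanish at Z = exp(rL), whereas Z
≠ 1 because F(p) ≠ 0. -/
theorem padeForm_ne_zero_or (hr : 2 ≤ r) (n : ℕ) (p q : ℤ × ℤ) (ω L L' : ℂ) (hω : ω ^ r = 1)
    (hp : d.eta p = ω * Complex.exp L * d.xi p) (hq : d.eta q = ω * Complex.exp L' * d.xi q)
    (hp0 : d.xi p ≠ 0) (hq0 : d.xi q ≠ 0) (hF : formEval F p.1 p.2 ≠ 0) :
    d.padeForm n p q ≠ 0 ∨ d.padeForm (n + 1) p q ≠ 0 := by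
  by_contra hcon
  push Not at hcon
  obtain ⟨h0, h1⟩ := hcon
  rw [d.padeForm_eq _ p q ω L L' hω hp hq] at h0 h1
  have hω0 : ω ≠ 0 := by
    rintro rfl
    rw [zero_pow (by omega)] at hω
    exact zero_ne_one hω
  have hpre : ∀ m, d.xi q * d.xi p * ω * (d.xi p ^ r) ^ m ≠ 0 := fun m =>
    mul_ne_zero (mul_ne_zero (mul_ne_zero hq0 hp0) hω0) (pow_ne_zero _ (pow_ne_zero _ hp0))
  have h0 := (mul_eq_zero.1 h0).resolve_left (hpre _)
  have h1 := (mul_eq_zero.1 h1).resolve_left (hpre _)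
  have hZ : Complex.exp (r * L) ≠ 1 := by
    intro hZ
    have hpr : d.eta p ^ r = Complex.exp (r * L) * d.xi p ^ r := by
      rw [hp, mul_pow, mul_pow, hω, one_mul, ← Complex.exp_nat_mul]
    have := d.xi_pow_sub_eta_pow p
    rw [hpr, hZ, one_mul, sub_self] at this
    exact hF (by exact_mod_cast this.symm)
  apply padeDet_eval_ne_zero hr n hZ
  rw [padeDet, Polynomial.eval_sub, Polynomial.eval_mul, Polynomial.eval_mul]
  refine (mul_eq_zero.1 ?_).resolve_left (Complex.exp_ne_zero L)
  linear_combination (padeA r n).eval (Complex.exp (r * L)) * h1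
    - (padeA r (n + 1)).eval (Complex.exp (r * L)) * h0

theorem norm_padeForm_le (hr : 5 ≤ r) (n : ℕ) (p q : ℤ × ℤ) (ω L L' : ℂ) (hω : ω ^ r = 1)
    (hp : d.eta p = ω * Complex.exp L * d.xi p) (hq : d.eta q = ω * Complex.exp L' * d.xi q)
    (z z' : ℝ) (hz : z ≤ 1 / 100) (hz' : z' ≤ 1 / 100) (hL : r * ‖L‖ ≤ 1.1 * z)
    (hL' : r * ‖L'‖ ≤ 1.1 * z') :
    ‖d.padeForm n p q‖ ≤ ‖d.xi q‖ * ‖d.xi p‖ ^ (r * n + 1) * (16 * (r : ℝ) ^ 2) ^ n *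
      (z ^ (2 * n + 1) + z') := by
  have hr' : (5 : ℝ) ≤ r := by exact_mod_cast hr
  have hω1 : ‖ω‖ = 1 := Complex.norm_eq_one_of_pow_eq_one hω (by omega)
  have hz0 : 0 ≤ z := by
    have : 0 ≤ r * ‖L‖ := by positivity
    linarith
  have hz0' : 0 ≤ z' := by
    have : 0 ≤ r * ‖L'‖ := by positivity
    linarith
  have hLz : 3 * ‖L‖ ≤ z := by nlinarith [norm_nonneg L]
  have hLz' : 2 * ‖L'‖ ≤ z' := by nlinarith [norm_nonneg L']
  -- The first term is the Padé remainder, of size z^(2n+1), and the second measures how far exp L'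
  -- is from 1, which is of size z'.
  have hdec : Complex.exp L * (padeB r n).eval (Complex.exp (r * L)) -
      Complex.exp L' * (padeA r n).eval (Complex.exp (r * L)) =
      padeNorm r n * padeIntegral r n L -
        (Complex.exp L' - 1) * (padeA r n).eval (Complex.exp (r * L)) := by
    rw [← pade_remainder (by omega)]; ring
  have hI : ‖(padeNorm r n : ℂ) * padeIntegral r n L‖ ≤ (16 * (r : ℝ) ^ 2) ^ n * z ^ (2 * n + 1) := by
    have h1 := norm_padeIntegral_le r n (by omega) L (by linarith)
    have h2 := padeNorm_le (r := r) (by omega) n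
    have h3 := (padeNorm_pos (r := r) (by omega) n).le
    rw [norm_mul, Complex.norm_real, Real.norm_of_nonneg h3]
    have h4 : 4 * (r * ‖L‖) ^ 2 ≤ 16 * z ^ 2 := by
      have : (r * ‖L‖) ^ 2 ≤ (1.1 * z) ^ 2 := by gcongr
      nlinarith
    calc padeNorm r n * ‖padeIntegral r n L‖
        ≤ ((r : ℝ) ^ 2) ^ n * (3 * ‖L‖ * (4 * (r * ‖L‖) ^ 2) ^ n) := by gcongr
      _ ≤ ((r : ℝ) ^ 2) ^ n * (z * (16 * z ^ 2) ^ n) := by gcongr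
      _ = _ := by rw [mul_pow, mul_pow]; ring
  have hA : ‖(padeA r n).eval (Complex.exp (r * L))‖ ≤ (16 * (r : ℝ) ^ 2) ^ n := by
    have hZ : ‖Complex.exp (r * L)‖ ≤ 2 := by
      have h1 : ‖(r : ℂ) * L‖ ≤ 1.1 * z := by rwa [norm_mul, Complex.norm_natCast]
      have h2 := Complex.norm_exp_sub_one_le (x := (r : ℂ) * L) (by linarith)
      have h3 := norm_sub_norm_le (Complex.exp (r * L)) 1
      rw [norm_one] at h3
      linarith
    rw [padeA_eval]
    calc ‖∑ l ∈ Finset.range (n + 1), (padeCoeff r n l : ℂ) * Complex.exp (r * L) ^ (n - l)‖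
        ≤ ∑ l ∈ Finset.range (n + 1), padeCoeff r n l * 2 ^ n := by
          refine norm_sum_le_of_le _ fun l hl => ?_
          have hl : l ≤ n := by simpa [Nat.lt_succ_iff] using hl
          have hc := (padeCoeff_pos (r := r) (by omega) hl).le
          rw [norm_mul, norm_pow, Complex.norm_real, Real.norm_of_nonneg hc]
          refine mul_le_mul_of_nonneg_left ?_ hc
          calc ‖Complex.exp (r * L)‖ ^ (n - l) ≤ 2 ^ (n - l) := by gcongr
            _ ≤ 2 ^ n := pow_le_pow_right₀ (by norm_num) (Nat.sub_le _ _)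
      _ = (∑ l ∈ Finset.range (n + 1), padeCoeff r n l) * 2 ^ n := by rw [Finset.sum_mul]
      _ ≤ (8 * (r : ℝ) ^ 2) ^ n * 2 ^ n := by
          gcongr
          exact padeCoeff_sum_le (by omega) n
      _ = _ := by rw [← mul_pow]; ring
  have hE : ‖Complex.exp L' - 1‖ ≤ z' :=
    (Complex.norm_exp_sub_one_le (by linarith [norm_nonneg L'])).trans hLz'
  have hbr : ‖Complex.exp L * (padeB r n).eval (Complex.exp (r * L)) -
      Complex.exp L' * (padeA r n).eval (Complex.exp (r * L))‖ ≤
      (16 * (r : ℝ) ^ 2) ^ n * (z ^ (2 * n + 1) + z') := by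
    rw [hdec]
    refine (norm_sub_le _ _).trans ?_
    have : ‖(Complex.exp L' - 1) * (padeA r n).eval (Complex.exp (r * L))‖ ≤
        z' * (16 * (r : ℝ) ^ 2) ^ n := by
      rw [norm_mul]; gcongr
    linarith
  rw [d.padeForm_eq n p q ω L L' hω hp hq, norm_mul, norm_mul, norm_mul, norm_mul, hω1, norm_pow,
    norm_pow, pow_succ, pow_mul, mul_one]
  calc _ ≤ ‖d.xi q‖ * ‖d.xi p‖ * (‖d.xi p‖ ^ r) ^ n *
        ((16 * (r : ℝ) ^ 2) ^ n * (z ^ (2 * n + 1) + z')) := by gcongr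
    _ = _ := by ring

end DiagonalData

/-! ### Inequalities for the sizes of the solutions -/

theorem add_five_sq_le (k : ℕ) : ((k : ℝ) + 5) ^ 2 ≤ 32 * 8 ^ k := by
  induction k with
  | zero => norm_num
  | succ k ih =>
    have : (0 : ℝ) ≤ k := by positivity
    rw [pow_succ (8 : ℝ) k]
    push_cast
    nlinarith

theorem one_le_of_pow_bound {r : ℕ} {J h : ℝ} (hr : 2 ≤ r) (hh : 1 ≤ h) (hJ0 : 0 ≤ J)
    (hJ : (r : ℝ) ^ 7 * h ^ 3 ≤ J ^ (r - 1)) : 1 ≤ J := by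
  have hr' : (1 : ℝ) ≤ r := by exact_mod_cast (by omega : 1 ≤ r)
  by_contra hlt
  push Not at hlt
  have h1 : (1 : ℝ) ≤ (r : ℝ) ^ 7 * h ^ 3 :=
    one_le_mul_of_one_le_of_one_le (one_le_pow₀ hr') (one_le_pow₀ hh)
  have := pow_lt_one₀ hJ0 hlt (by omega : r - 1 ≠ 0)
  linarith

/-- For J ≥ 1 and r ≥ 5 one has (16J²)^(r-2) ≥ 4r²(2J)^r: the power of J is large enough because
2(r-2) ≥ r, and the constants are compared by `add_five_sq_le`. -/
theorem sqrt_disc_le {r : ℕ} (hr : 5 ≤ r) {J Q : ℝ} (hJ : 1 ≤ J)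
    (hQ : Q ^ (r - 2) ≤ 4 * (r : ℝ) ^ 2 * (2 * J) ^ r) : Q ≤ 16 * J ^ 2 := by
  obtain ⟨k, rfl⟩ : ∃ k, r = k + 5 := ⟨r - 5, by omega⟩
  by_contra hlt
  push Not at hlt
  have h1 : (16 * J ^ 2) ^ (k + 3) < Q ^ (k + 3) :=
    pow_lt_pow_left₀ hlt (by positivity) (by omega)
  have h2 : 4 * ((k + 5 : ℕ) : ℝ) ^ 2 * (2 * J) ^ (k + 5) ≤ (16 * J ^ 2) ^ (k + 3) := by
    have h3 : J ^ (k + 5) ≤ J ^ (2 * (k + 3)) := pow_le_pow_right₀ hJ (by omega)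
    have h4 := add_five_sq_le k
    have e1 : (16 : ℝ) ^ (k + 3) = 4 * (32 * 8 ^ k) * 2 ^ (k + 5) := by
      rw [show (16 : ℝ) = 8 * 2 by norm_num, mul_pow, pow_add, pow_add, pow_add]; ring
    rw [mul_pow, mul_pow, ← pow_mul, e1]
    push_cast
    calc 4 * ((k : ℝ) + 5) ^ 2 * (2 ^ (k + 5) * J ^ (k + 5))
        ≤ 4 * (32 * 8 ^ k) * (2 ^ (k + 5) * J ^ (2 * (k + 3))) := by gcongr
      _ = _ := by ring
  rw [show k + 5 - 2 = k + 3 by omega] at hQ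
  linarith

/-- The size conditions on `J`, on a solution of size `X`, and on the factor `M` that is lost in
each step of the Padé approximations. -/
theorem size_conditions {r : ℕ} (hr : 5 ≤ r) {J h M X : ℝ} (hh : 1 ≤ h) (hJ1 : 1 ≤ J)
    (hJ : (r : ℝ) ^ 7 * h ^ 3 ≤ J ^ (r - 1)) (hJ5 : r = 5 → h ≤ J) (hM0 : 0 ≤ M)
    (hM : M ≤ 512 * (r : ℝ) ^ 3 * J ^ 2) (hX0 : 0 < X)
    (hX : 16 * J ^ 2 * (r : ℝ) ^ 7 * h ≤ X ^ 2) :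
    1 < X ∧ M * h ^ 2 ≤ X ^ (r - 2) ∧ h ^ r * M ^ 2 < J ^ r * X ^ (r * (r - 4)) := by
  have hr' : (5 : ℝ) ≤ r := by exact_mod_cast hr
  have hJ0 : 0 < J := by linarith
  have hr7 : (1 : ℝ) ≤ (r : ℝ) ^ 7 := one_le_pow₀ (by linarith)
  have hJ2 : (1 : ℝ) ≤ J ^ 2 := one_le_pow₀ hJ1
  have hXh : 16 * h ≤ X ^ 2 := by
    refine le_trans ?_ hX
    have : 1 ≤ J ^ 2 * (r : ℝ) ^ 7 := one_le_mul_of_one_le_of_one_le hJ2 hr7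
    nlinarith
  have hX1 : 1 < X := by nlinarith
  have hXh' : h ≤ X ^ 2 := by linarith
  have hr8 : (390625 : ℝ) ≤ (r : ℝ) ^ 8 := by
    calc (390625 : ℝ) = 5 ^ 8 := by norm_num
      _ ≤ _ := by gcongr
  have hX4 : M ^ 2 * h ^ 2 < X ^ 4 := by
    calc M ^ 2 * h ^ 2 ≤ (512 * (r : ℝ) ^ 3 * J ^ 2) ^ 2 * h ^ 2 := by gcongr
      _ = 262144 * ((r : ℝ) ^ 6 * J ^ 4 * h ^ 2) := by ring
      _ < (256 * (r : ℝ) ^ 8) * ((r : ℝ) ^ 6 * J ^ 4 * h ^ 2) := by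
          apply mul_lt_mul_of_pos_right _ (by positivity)
          linarith
      _ = (16 * J ^ 2 * (r : ℝ) ^ 7 * h) ^ 2 := by ring
      _ ≤ (X ^ 2) ^ 2 := by gcongr
      _ = X ^ 4 := by ring
  have hM4 : M ^ 2 < X ^ 4 := by
    refine lt_of_le_of_lt ?_ hX4
    have : (1 : ℝ) ≤ h ^ 2 := one_le_pow₀ hh
    nlinarith [sq_nonneg M]
  refine ⟨hX1, ?_, ?_⟩
  -- For r ≥ 6 there are at least four powers of X available. For r = 5 there are only three, and
  -- the missing one is paid for by h ≤ J.
  · rcases Nat.lt_or_ge 5 r with h6 | h6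
    · calc M * h ^ 2 ≤ 512 * (r : ℝ) ^ 3 * J ^ 2 * h ^ 2 := by gcongr
        _ ≤ (16 * J ^ 2 * (r : ℝ) ^ 7 * h) ^ 2 := by
            have h1 : 512 * (r : ℝ) ^ 3 ≤ 256 * (r : ℝ) ^ 14 := by
              have : (r : ℝ) ^ 14 = r ^ 3 * (r ^ 8 * r ^ 3) := by ring
              have h3 : (1 : ℝ) ≤ (r : ℝ) ^ 3 := one_le_pow₀ (by linarith)
              have h4 : (2 : ℝ) ≤ (r : ℝ) ^ 8 * r ^ 3 := by nlinarith
              rw [this]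
              nlinarith
            calc 512 * (r : ℝ) ^ 3 * J ^ 2 * h ^ 2 = 512 * (r : ℝ) ^ 3 * (J ^ 2 * h ^ 2) := by ring
              _ ≤ 256 * (r : ℝ) ^ 14 * (J ^ 4 * h ^ 2) := by
                  gcongr
                  norm_num
              _ = _ := by ring
        _ ≤ (X ^ 2) ^ 2 := by gcongr
        _ = X ^ 4 := by ring
        _ ≤ X ^ (r - 2) := pow_le_pow_right₀ hX1.le (by omega)
    · have hr5 : r = 5 := by omega
      have hhJ := hJ5 hr5
      subst hr5
      have h1 : (M * h ^ 2) ^ 2 ≤ (X ^ 3) ^ 2 := by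
        calc (M * h ^ 2) ^ 2 = (M ^ 2 * h ^ 2) * h ^ 2 := by ring
          _ ≤ X ^ 4 * (16 * J ^ 2 * ((5 : ℕ) : ℝ) ^ 7 * h) := by
              gcongr
              push_cast
              nlinarith [mul_le_mul hhJ hhJ (by linarith) hJ0.le]
          _ ≤ X ^ 4 * X ^ 2 := by gcongr
          _ = _ := by ring
      exact abs_le_of_sq_le_sq' h1 (by positivity) |>.2
  · rcases Nat.lt_or_ge 5 r with h6 | h6
    · rcases Nat.lt_or_ge 6 r with h7 | h7
      · obtain ⟨k, rfl⟩ : ∃ k, r = k + 7 := ⟨r - 7, by omega⟩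
        have h1 : h ^ (k + 7) ≤ X ^ (2 * (k + 7)) := by
          rw [pow_mul]; gcongr
        have h2 : (1 : ℝ) ≤ J ^ (k + 7) := one_le_pow₀ hJ1
        calc h ^ (k + 7) * M ^ 2 < h ^ (k + 7) * X ^ 4 := by gcongr
          _ ≤ X ^ (2 * (k + 7)) * X ^ 4 := by gcongr
          _ = X ^ (2 * (k + 7) + 4) := by rw [pow_add]
          _ ≤ X ^ ((k + 7) * (k + 7 - 4)) := by
              refine pow_le_pow_right₀ hX1.le ?_
              rw [show k + 7 - 4 = k + 3 by omega]
              nlinarith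
          _ ≤ J ^ (k + 7) * X ^ ((k + 7) * (k + 7 - 4)) := le_mul_of_one_le_left (by positivity) h2
      · have hr6 : r = 6 := by omega
        subst hr6
        have h1 : h ^ 3 ≤ J ^ 6 := by
          calc h ^ 3 ≤ ((6 : ℕ) : ℝ) ^ 7 * h ^ 3 := le_mul_of_one_le_left (by positivity) hr7
            _ ≤ J ^ 5 := hJ
            _ ≤ J ^ 6 := pow_le_pow_right₀ hJ1 (by norm_num)
        have h2 : h ^ 3 ≤ X ^ 6 := by
          calc h ^ 3 ≤ (X ^ 2) ^ 3 := by gcongr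
            _ = X ^ 6 := by ring
        calc h ^ 6 * M ^ 2 < h ^ 6 * X ^ 4 := by gcongr
          _ = h ^ 3 * h ^ 3 * X ^ 4 := by ring
          _ ≤ J ^ 6 * X ^ 6 * X ^ 4 := by gcongr
          _ = J ^ 6 * X ^ 10 := by ring
          _ ≤ J ^ 6 * X ^ (6 * (6 - 4)) := by
              gcongr
              · exact hX1.le
              · norm_num
    · have hr5 : r = 5 := by omega
      have hhJ := hJ5 hr5
      subst hr5
      calc h ^ 5 * M ^ 2 < h ^ 5 * X ^ 4 := by gcongr
        _ ≤ J ^ 5 * X ^ (5 * (5 - 4)) := by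
            gcongr
            · exact hX1.le
            · norm_num

/-- With M = 32r³Q, the bound for B k is a sum of two terms: Yh(Mh²)^k / (X^(r-1) X^(rk)) decreases
with k, and hX(MX^r)^k / Y^(r-1) is nondecreasing. At the first k where the former drops below J,
the latter is still below J for k and k + 1, so two consecutive values are below 2J. -/
theorem pade_sizes_absurd {r : ℕ} (hr : 5 ≤ r) {J h Q X Y : ℝ} (hh : 1 ≤ h) (hQ1 : 1 ≤ Q)
    (hJ1 : 1 ≤ J) (hJ : (r : ℝ) ^ 7 * h ^ 3 ≤ J ^ (r - 1)) (hJ5 : r = 5 → h ≤ J)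
    (hQ : Q ^ (r - 2) ≤ 4 * (r : ℝ) ^ 2 * (2 * J) ^ r)
    (hX0 : 0 < X) (hX : 16 * J ^ 2 * (r : ℝ) ^ 7 * h ≤ X ^ 2)
    (hgap : J * X ^ (r - 1) ≤ h * Y)
    (B : ℕ → ℝ) (hB : ∀ n, B n ≤ (2 * r * Q) ^ n * (Y * X ^ (r * n + 1) * (16 * (r : ℝ) ^ 2) ^ n *
      ((h / X ^ r) ^ (2 * n + 1) + h / Y ^ r)))
    (hpade : ∀ n, 2 * J ≤ B n ∨ 2 * J ≤ B (n + 1)) : False := by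
  have hr' : (5 : ℝ) ≤ r := by exact_mod_cast hr
  have hJ0 : 0 < J := by linarith
  have hh0 : 0 < h := by linarith
  have hQ16 := sqrt_disc_le hr hJ1 hQ
  set M : ℝ := 32 * r ^ 3 * Q with hMdef
  have hr3 : (1 : ℝ) ≤ (r : ℝ) ^ 3 := one_le_pow₀ (by linarith)
  have hM1 : 1 ≤ M := by
    have : 1 ≤ (r : ℝ) ^ 3 * Q := one_le_mul_of_one_le_of_one_le hr3 hQ1
    rw [hMdef]; nlinarith
  have hM0 : 0 < M := by linarith
  have hM : M ≤ 512 * (r : ℝ) ^ 3 * J ^ 2 := by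
    rw [hMdef]
    have : (r : ℝ) ^ 3 * Q ≤ (r : ℝ) ^ 3 * (16 * J ^ 2) := by gcongr
    nlinarith
  obtain ⟨hX1, hc2, hc1⟩ := size_conditions hr hh hJ1 hJ hJ5 hM0.le hM hX0 hX
  have hY0 : 0 < Y := by
    have : 0 < J * X ^ (r - 1) := by positivity
    have : 0 < h * Y := by linarith
    exact pos_of_mul_pos_right this hh0.le
  have hMV : M * h ^ 2 < X ^ r :=
    hc2.trans_lt (pow_lt_pow_right₀ hX1 (by omega))
  have hMV1 : 1 ≤ M * X ^ r :=
    one_le_mul_of_one_le_of_one_le hM1 (one_le_pow₀ hX1.le)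
  have hex : ∃ n, Y * h * (M * h ^ 2) ^ n < J * X ^ (r - 1) * (X ^ r) ^ n := by
    have hgt : 1 < X ^ r / (M * h ^ 2) := (one_lt_div (by positivity)).2 hMV
    obtain ⟨n, hn⟩ := pow_unbounded_of_one_lt (Y * h / (J * X ^ (r - 1))) hgt
    refine ⟨n, ?_⟩
    rw [div_pow, div_lt_div_iff₀ (by positivity) (by positivity)] at hn
    linarith
  have hbound : ∀ k, Y * h * (M * h ^ 2) ^ k < J * X ^ (r - 1) * (X ^ r) ^ k →
      h * X * (M * X ^ r) ^ k < J * Y ^ (r - 1) → B k < 2 * J := by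
    intro k h1 h2
    refine (hB k).trans_lt ?_
    have eY : Y ^ r = Y ^ (r - 1) * Y := by rw [← pow_succ, Nat.sub_add_cancel (by omega)]
    have eX : X ^ r = X ^ (r - 1) * X := by rw [← pow_succ, Nat.sub_add_cancel (by omega)]
    have e : (2 * r * Q) ^ k * (Y * X ^ (r * k + 1) * (16 * (r : ℝ) ^ 2) ^ k *
        ((h / X ^ r) ^ (2 * k + 1) + h / Y ^ r)) =
        (Y * h * (M * h ^ 2) ^ k) / (X ^ (r - 1) * (X ^ r) ^ k) +
        (h * X * (M * X ^ r) ^ k) / Y ^ (r - 1) := by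
      have e0 : M ^ k = (2 * r * Q) ^ k * (16 * (r : ℝ) ^ 2) ^ k := by
        rw [← mul_pow, hMdef]; ring
      rw [mul_pow M, mul_pow M, e0, pow_succ X, pow_mul X, eY, div_pow, pow_succ (X ^ r),
        pow_mul (X ^ r), pow_succ h, pow_mul h]
      have hXr : X ^ r ≠ 0 := by positivity
      set V := X ^ r
      have eX' : X ^ (r - 1) = V / X := by rw [eX]; field_simp
      rw [eX']
      field_simp
      ring
    rw [e]
    have f1 : (Y * h * (M * h ^ 2) ^ k) / (X ^ (r - 1) * (X ^ r) ^ k) < J := by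
      rw [div_lt_iff₀ (by positivity)]; linarith
    have f2 : (h * X * (M * X ^ r) ^ k) / Y ^ (r - 1) < J := by
      rw [div_lt_iff₀ (by positivity)]; linarith
    linarith
  classical
  -- Minimality of n gives a lower bound for Y in terms of X, which controls the second term. The
  -- gap hypothesis excludes n = 0, so that n - 1 can be used.
  let n := Nat.find hex
  have hn := Nat.find_spec hex
  have hmin : ∀ m < n, J * X ^ (r - 1) * (X ^ r) ^ m ≤ Y * h * (M * h ^ 2) ^ m := fun m hm =>
    not_lt.1 (Nat.find_min hex hm)
  have hn0 : n ≠ 0 := by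
    intro h0
    have : Y * h * (M * h ^ 2) ^ n < J * X ^ (r - 1) * (X ^ r) ^ n := hn
    rw [h0] at this
    simp only [pow_zero, mul_one] at this
    linarith
  obtain ⟨m, hm⟩ := Nat.exists_eq_succ_of_ne_zero hn0
  have hn : Y * h * (M * h ^ 2) ^ (m + 1) < J * X ^ (r - 1) * (X ^ r) ^ (m + 1) := by
    have : Y * h * (M * h ^ 2) ^ n < J * X ^ (r - 1) * (X ^ r) ^ n := hn
    rwa [hm] at this
  have hn2 : Y * h * (M * h ^ 2) ^ (m + 2) < J * X ^ (r - 1) * (X ^ r) ^ (m + 2) := by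
    rw [pow_succ (M * h ^ 2) (m + 1), pow_succ (X ^ r) (m + 1), ← mul_assoc (Y * h),
      ← mul_assoc (J * X ^ (r - 1))]
    exact mul_lt_mul'' hn hMV (by positivity) (by positivity)
  have hlow := hmin m (by omega)
  -- The lower bound for Y from index m is raised to the power r - 1. The claim then splits into the
  -- case m = 0 (`hc1'`) and the growth from one m to the next (`hc2'`); these are the two size
  -- conditions on X.
  have hW2 : h * X * (M * X ^ r) ^ (m + 2) < J * Y ^ (r - 1) := by
    have hp : (J * X ^ (r - 1) * (X ^ r) ^ m) ^ (r - 1) ≤ (Y * h * (M * h ^ 2) ^ m) ^ (r - 1) := by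
      gcongr
    have hc1' : h ^ r * X * (M * X ^ r) ^ 2 < J * (J * X ^ (r - 1)) ^ (r - 1) := by
      have e1 : J * (J * X ^ (r - 1)) ^ (r - 1) = J ^ r * X ^ (r * (r - 4)) * (X * (X ^ r) ^ 2) := by
        rw [mul_pow, ← mul_assoc, ← pow_succ', Nat.sub_add_cancel (by omega : 1 ≤ r), mul_assoc]
        congr 1
        rw [← pow_mul, ← pow_mul, ← pow_succ', ← pow_add]
        congr 1
        obtain ⟨k, rfl⟩ : ∃ k, r = k + 5 := ⟨r - 5, by omega⟩
        simp only [show k + 5 - 1 = k + 4 by omega,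
          show k + 5 - 4 = k + 1 by omega]
        ring
      rw [e1]
      calc h ^ r * X * (M * X ^ r) ^ 2 = h ^ r * M ^ 2 * (X * (X ^ r) ^ 2) := by ring
        _ < _ := mul_lt_mul_of_pos_right hc1 (by positivity)
    have hc2' : (M * X ^ r) * (M * h ^ 2) ^ (r - 1) ≤ (X ^ r) ^ (r - 1) := by
      have e2 : (X ^ r) ^ (r - 1) = X ^ r * (X ^ (r - 2)) ^ r := by
        rw [← pow_mul, ← pow_mul, ← pow_add]
        congr 1
        obtain ⟨k, rfl⟩ : ∃ k, r = k + 5 := ⟨r - 5, by omega⟩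
        simp only [show k + 5 - 1 = k + 4 by omega, show k + 5 - 2 = k + 3 by omega]
        ring
      rw [e2]
      have h2 : (1 : ℝ) ≤ h ^ 2 := one_le_pow₀ hh
      calc (M * X ^ r) * (M * h ^ 2) ^ (r - 1) ≤ (M * h ^ 2 * X ^ r) * (M * h ^ 2) ^ (r - 1) := by
            gcongr
            exact le_mul_of_one_le_right hM0.le h2
        _ = X ^ r * ((M * h ^ 2) ^ (r - 1) * (M * h ^ 2)) := by ring
        _ = X ^ r * (M * h ^ 2) ^ r := by rw [← pow_succ, Nat.sub_add_cancel (by omega)]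
        _ ≤ _ := by gcongr
    have hpos : 0 < h ^ (r - 1) * ((M * h ^ 2) ^ m) ^ (r - 1) := by positivity
    refine lt_of_mul_lt_mul_right ?_ hpos.le
    calc h * X * (M * X ^ r) ^ (m + 2) * (h ^ (r - 1) * ((M * h ^ 2) ^ m) ^ (r - 1))
        = (h ^ (r - 1) * h * X * (M * X ^ r) ^ 2) * ((M * X ^ r) * (M * h ^ 2) ^ (r - 1)) ^ m := by
          rw [pow_right_comm (M * h ^ 2), mul_pow (M * X ^ r), pow_add]; ring
      _ = (h ^ r * X * (M * X ^ r) ^ 2) * ((M * X ^ r) * (M * h ^ 2) ^ (r - 1)) ^ m := by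
          rw [← pow_succ, Nat.sub_add_cancel (by omega)]
      _ < (J * (J * X ^ (r - 1)) ^ (r - 1)) * ((M * X ^ r) * (M * h ^ 2) ^ (r - 1)) ^ m :=
          mul_lt_mul_of_pos_right hc1' (by positivity)
      _ ≤ (J * (J * X ^ (r - 1)) ^ (r - 1)) * ((X ^ r) ^ (r - 1)) ^ m := by gcongr
      _ = J * (J * X ^ (r - 1) * (X ^ r) ^ m) ^ (r - 1) := by
          rw [mul_pow (J * X ^ (r - 1)), pow_right_comm (X ^ r)]; ring
      _ ≤ J * (Y * h * (M * h ^ 2) ^ m) ^ (r - 1) := by gcongr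
      _ = _ := by rw [mul_pow, mul_pow]; ring
  have hW1 : h * X * (M * X ^ r) ^ (m + 1) < J * Y ^ (r - 1) := by
    refine lt_of_le_of_lt ?_ hW2
    gcongr ?_ * ?_
    exact pow_le_pow_right₀ hMV1 (by omega)
  rcases hpade (m + 1) with h1 | h1
  · exact absurd (hbound _ hn hW1) (not_lt.2 h1)
  · exact absurd (hbound _ hn2 hW2) (not_lt.2 h1)

/-! ### Large solutions and the gap principle -/

theorem eq_or_eq_neg_of_det_eq_zero {p q : ℤ × ℤ} (hp : Int.gcd p.1 p.2 = 1)
    (hq : Int.gcd q.1 q.2 = 1) (h : p.1 * q.2 - q.1 * p.2 = 0) : q = p ∨ q = -p := by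
  obtain ⟨u, v, huv⟩ := Int.isCoprime_iff_gcd_eq_one.2 hp
  -- Since p is primitive, Bézout coefficients for p give the integer k with q = kp; primitivity of
  -- q makes k a unit.
  set k := u * q.1 + v * q.2 with hk
  have h1 : q.1 = p.1 * k := by rw [hk]; linear_combination (-q.1) * huv - v * h
  have h2 : q.2 = p.2 * k := by rw [hk]; linear_combination (-q.2) * huv + u * h
  have hu : IsUnit k := (Int.isCoprime_iff_gcd_eq_one.2 hq).isUnit_of_dvd'
    ⟨p.1, by rw [h1, mul_comm]⟩ ⟨p.2, by rw [h2, mul_comm]⟩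
  rcases Int.isUnit_iff.1 hu with hk1 | hk1
  · left; ext
    · rw [h1, hk1, mul_one]
    · rw [h2, hk1, mul_one]
  · right; ext
    · rw [h1, hk1, Prod.fst_neg]; ring
    · rw [h2, hk1, Prod.snd_neg]; ring

theorem det_ne_zero_of_pair_ne {F : MvPolynomial (Fin 2) ℤ} {h : ℤ} {p q : ℤ × ℤ}
    (hp : p ∈ primitiveSolutions F h) (hq : q ∈ primitiveSolutions F h)
    (hne : s(p, -p) ≠ s(q, -q)) : p.1 * q.2 - q.1 * p.2 ≠ 0 := by
  intro h0
  rcases eq_or_eq_neg_of_det_eq_zero hp.1 hq.1 h0 with rfl | rfl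
  · exact hne rfl
  · exact hne (by rw [neg_neg, Sym2.eq_swap])

namespace DiagonalData

variable {r : ℕ} {F : MvPolynomial (Fin 2) ℤ} (d : DiagonalData r F)

/-- Half the absolute value of the determinant of the two linear forms. -/
def halfDet : ℝ := ‖d.α * d.δ - d.β * d.γ‖ / 2

/-- The larger absolute value of the two linear forms. -/
def height (p : ℤ × ℤ) : ℝ := max ‖d.xi p‖ ‖d.eta p‖

/-- A point whose height is at least the square root of half the determinant. -/
def IsLarge (p : ℤ × ℤ) : Prop := d.halfDet ≤ d.height p ^ 2

/-- The logarithm of `eta / xi` at `p`, up to the nearest `r`-th root of unity. -/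
def logRatio (p : ℤ × ℤ) : ℂ := Complex.log ((d.eta p / d.xi p) ^ r) / r

/-- The `r`-th root of unity nearest to `eta / xi` at `p`. -/
def nearestRoot (p : ℤ × ℤ) : ℂ := d.eta p / d.xi p * Complex.exp (-d.logRatio p)

theorem height_nonneg (p : ℤ × ℤ) : 0 ≤ d.height p := le_max_of_le_left (norm_nonneg _)

theorem norm_det_le (p q : ℤ × ℤ) (h : p.1 * q.2 - q.1 * p.2 ≠ 0) :
    2 * d.halfDet ≤ ‖d.xi p * d.eta q - d.xi q * d.eta p‖ := by
  have h1 : (1 : ℝ) ≤ ‖((p.1 * q.2 - q.1 * p.2 : ℤ) : ℂ)‖ := by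
    rw [Complex.norm_intCast]; exact_mod_cast Int.one_le_abs h
  rw [d.xi_mul_eta_sub, ← d.det, norm_mul, halfDet]
  nlinarith [norm_nonneg (d.α * d.δ - d.β * d.γ)]

/-- A nonzero determinant gives 2J ≤ |ξ(p)η(q) - ξ(q)η(p)| ≤ 2H(p)H(q), where H is the height, so
the heights cannot both be below √J. -/
theorem isLarge_or_isLarge (p q : ℤ × ℤ) (h : p.1 * q.2 - q.1 * p.2 ≠ 0) :
    d.IsLarge p ∨ d.IsLarge q := by
  by_contra hcon
  push Not at hcon
  obtain ⟨hp, hq⟩ := hcon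
  rw [IsLarge, not_le] at hp hq
  have h1 := d.norm_det_le p q h
  have h2 : ‖d.xi p * d.eta q - d.xi q * d.eta p‖ ≤ 2 * (d.height p * d.height q) := by
    refine (norm_sub_le _ _).trans ?_
    rw [norm_mul, norm_mul]
    have a1 : ‖d.xi p‖ ≤ d.height p := le_max_left _ _
    have a2 : ‖d.eta p‖ ≤ d.height p := le_max_right _ _
    have a3 : ‖d.xi q‖ ≤ d.height q := le_max_left _ _
    have a4 : ‖d.eta q‖ ≤ d.height q := le_max_right _ _
    have b1 := mul_le_mul a1 a4 (norm_nonneg _) (d.height_nonneg p)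
    have b2 := mul_le_mul a3 a2 (norm_nonneg _) (d.height_nonneg q)
    linarith
  nlinarith [sq_nonneg (d.height p - d.height q)]

theorem norm_xi_pow_sub_le {h : ℤ} {p : ℤ × ℤ} (hp : p ∈ primitiveSolutions F h) :
    ‖d.xi p ^ r - d.eta p ^ r‖ ≤ h := by
  rw [d.xi_pow_sub_eta_pow, Complex.norm_intCast]
  exact_mod_cast hp.2.2

/-- At a large point h is at most 1/200 of the r-th power of the height, so |ξ|^r and |η|^r nearly
agree. Hence |ξ| may replace the height even where |η| is the larger one. -/
theorem IsLarge.norm_xi_pow {d : DiagonalData r F} (hr : 5 ≤ r) {h : ℤ} (hh : 0 < h)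
    (hJ : (r : ℝ) ^ 7 * (h : ℝ) ^ 3 ≤ d.halfDet ^ (r - 1)) {p : ℤ × ℤ}
    (hp : p ∈ primitiveSolutions F h) (hl : d.IsLarge p) :
    0.99 * d.height p ^ (r - 1) ≤ ‖d.xi p‖ ^ (r - 1) ∧ 0 < ‖d.xi p‖ ∧ h / ‖d.xi p‖ ^ r ≤ 1 / 100 := by
  have hh1 : (1 : ℝ) ≤ h := by exact_mod_cast hh
  have hr' : (5 : ℝ) ≤ r := by exact_mod_cast hr
  have hJ0 : 0 ≤ d.halfDet := by unfold halfDet; positivity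
  have hJ1 := one_le_of_pow_bound (by omega) hh1 hJ0 hJ
  have hH0 := d.height_nonneg p
  -- In squared form: 40000h² ≤ 5^7 h^3 ≤ J^(r-1) ≤ J^r ≤ H^(2r), where H is the height.
  have hHr : 200 * (h : ℝ) ≤ d.height p ^ r := by
    refine abs_le_of_sq_le_sq' ?_ (by positivity) |>.2
    have h7 : (78125 : ℝ) ≤ (r : ℝ) ^ 7 := by
      calc (78125 : ℝ) = 5 ^ 7 := by norm_num
        _ ≤ _ := by gcongr
    calc (200 * (h : ℝ)) ^ 2 = 40000 * (h : ℝ) ^ 2 := by ring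
      _ ≤ (r : ℝ) ^ 7 * (h : ℝ) ^ 3 := by
          have h3 : (h : ℝ) ^ 2 ≤ (h : ℝ) ^ 3 := pow_le_pow_right₀ hh1 (by norm_num)
          have : (0 : ℝ) ≤ (h : ℝ) ^ 2 := by positivity
          nlinarith
      _ ≤ d.halfDet ^ (r - 1) := hJ
      _ ≤ d.halfDet ^ r := pow_le_pow_right₀ hJ1 (by omega)
      _ ≤ (d.height p ^ 2) ^ r := by
          have : d.halfDet ≤ d.height p ^ 2 := hl
          gcongr
      _ = (d.height p ^ r) ^ 2 := by ring
  have hsub := d.norm_xi_pow_sub_le hp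
  have hX : 0.995 * d.height p ^ r ≤ ‖d.xi p‖ ^ r := by
    rcases max_choice ‖d.xi p‖ ‖d.eta p‖ with hm | hm
    · have : d.height p = ‖d.xi p‖ := hm
      rw [this] at hHr ⊢
      nlinarith
    · have h1 : d.height p = ‖d.eta p‖ := hm
      rw [h1] at hHr ⊢
      have h2 := norm_sub_norm_le (d.eta p ^ r) (d.xi p ^ r)
      rw [norm_sub_rev, norm_pow, norm_pow] at h2
      nlinarith
  have hHpos : 0 < d.height p := by
    rcases hH0.lt_or_eq with h0 | h0
    · exact h0
    · rw [← h0, zero_pow (by omega)] at hHr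
      linarith
  have hXr : 100 * (h : ℝ) ≤ ‖d.xi p‖ ^ r := by linarith
  have hX0 : 0 < ‖d.xi p‖ := by
    rcases (norm_nonneg (d.xi p)).lt_or_eq with h0 | h0
    · exact h0
    · rw [← h0, zero_pow (by omega)] at hXr
      linarith
  refine ⟨?_, hX0, ?_⟩
  · have h1 : ‖d.xi p‖ ≤ d.height p := le_max_left _ _
    have e1 : d.height p ^ r = d.height p ^ (r - 1) * d.height p := by
      rw [← pow_succ, Nat.sub_add_cancel (by omega)]
    have e2 : ‖d.xi p‖ ^ r = ‖d.xi p‖ ^ (r - 1) * ‖d.xi p‖ := by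
      rw [← pow_succ, Nat.sub_add_cancel (by omega)]
    have h2 : ‖d.xi p‖ ^ (r - 1) * ‖d.xi p‖ ≤ ‖d.xi p‖ ^ (r - 1) * d.height p := by gcongr
    have h3 : 0.995 * d.height p ^ (r - 1) * d.height p ≤ ‖d.xi p‖ ^ (r - 1) * d.height p := by
      linarith
    have h4 := le_of_mul_le_mul_right h3 hHpos
    have h5 : 0 ≤ d.height p ^ (r - 1) := by positivity
    linarith
  · rw [div_le_div_iff₀ (by positivity) (by norm_num)]
    linarith

/-- (η/ξ)^r differs from 1 by at most h/|ξ|^r ≤ 1/100, so its principal logarithm is small; dividing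
that logarithm by r and removing its exponential from η/ξ leaves an exact r-th root of unity. -/
theorem nearestRoot_spec (hr : 5 ≤ r) {h : ℤ} {p : ℤ × ℤ} (hp : p ∈ primitiveSolutions F h)
    (hX : 0 < ‖d.xi p‖) (hz : h / ‖d.xi p‖ ^ r ≤ 1 / 100) :
    d.nearestRoot p ^ r = 1 ∧ d.eta p = d.nearestRoot p * Complex.exp (d.logRatio p) * d.xi p ∧
      r * ‖d.logRatio p‖ ≤ 1.1 * (h / ‖d.xi p‖ ^ r) := by
  have hX0 : d.xi p ≠ 0 := norm_pos_iff.1 hX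
  have hr0 : (r : ℂ) ≠ 0 := by exact_mod_cast (by omega : r ≠ 0)
  have hy : ‖(d.eta p / d.xi p) ^ r - 1‖ ≤ h / ‖d.xi p‖ ^ r := by
    have e : (d.eta p / d.xi p) ^ r - 1 = -(d.xi p ^ r - d.eta p ^ r) / d.xi p ^ r := by
      rw [div_pow]; field_simp; ring
    rw [e, norm_div, norm_neg, norm_pow]
    gcongr
    exact d.norm_xi_pow_sub_le hp
  have hu : (d.eta p / d.xi p) ^ r ≠ 0 := by
    intro h0
    rw [h0] at hy
    norm_num at hy
    linarith
  have hrL : r * d.logRatio p = Complex.log ((d.eta p / d.xi p) ^ r) := by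
    rw [logRatio, mul_div_cancel₀ _ hr0]
  refine ⟨?_, ?_, ?_⟩
  · rw [nearestRoot, mul_pow, ← Complex.exp_nat_mul, mul_neg, hrL, Complex.exp_neg,
      Complex.exp_log hu, mul_inv_cancel₀ hu]
  · rw [nearestRoot, mul_assoc (d.eta p / d.xi p), ← Complex.exp_add]
    simp only [neg_add_cancel, Complex.exp_zero, mul_one]
    field_simp
  · have h1 : (r : ℝ) * ‖d.logRatio p‖ = ‖Complex.log (1 + ((d.eta p / d.xi p) ^ r - 1))‖ := by
      rw [add_sub_cancel, ← hrL, norm_mul, Complex.norm_natCast]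
    rw [h1]
    set y := (d.eta p / d.xi p) ^ r - 1
    have h2 := Complex.norm_log_one_add_le (z := y) (by linarith)
    have h3 : (1 - ‖y‖)⁻¹ ≤ 2 := by
      rw [inv_le_comm₀ (by linarith) (by norm_num)]
      linarith
    have h4 : ‖y‖ ^ 2 * (1 - ‖y‖)⁻¹ ≤ ‖y‖ ^ 2 * 2 := by gcongr
    nlinarith [norm_nonneg y]

theorem norm_exp_sub_one_le_of_small {L : ℂ} (hL : ‖L‖ ≤ 1 / 100) :
    ‖Complex.exp L - 1‖ ≤ 1.01 * ‖L‖ := by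
  have h1 := Complex.norm_exp_sub_one_sub_id_le (x := L) (by linarith)
  have h2 := norm_add_le (Complex.exp L - 1 - L) L
  rw [sub_add_cancel] at h2
  nlinarith [norm_nonneg L]

/-- As ω is common, the determinant ξ(p)η(q) - ξ(q)η(p) is ξ(p)ξ(q)ω times the difference of two
exponentials, each within about h/(r|ξ(p)|^r) of 1, while its absolute value is at least 2J. -/
theorem gap (hr : 5 ≤ r) {h : ℤ} {p q : ℤ × ℤ} (hp : p ∈ primitiveSolutions F h)
    (hq : q ∈ primitiveSolutions F h) (hXp : 0 < ‖d.xi p‖) (hzp : h / ‖d.xi p‖ ^ r ≤ 1 / 100)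
    (hle : ‖d.xi p‖ ≤ ‖d.xi q‖) (hω : d.nearestRoot p = d.nearestRoot q)
    (hdet : p.1 * q.2 - q.1 * p.2 ≠ 0) (hh : 0 < h) :
    4.5 * d.halfDet * ‖d.xi p‖ ^ (r - 1) ≤ h * ‖d.xi q‖ := by
  have hh1 : (1 : ℝ) ≤ h := by exact_mod_cast hh
  have hr' : (5 : ℝ) ≤ r := by exact_mod_cast hr
  have hzz : h / ‖d.xi q‖ ^ r ≤ h / ‖d.xi p‖ ^ r := by gcongr
  obtain ⟨h1, h2, h3⟩ := d.nearestRoot_spec hr hp hXp hzp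
  obtain ⟨-, h5, h6⟩ := d.nearestRoot_spec hr hq (hXp.trans_le hle) (hzz.trans hzp)
  rw [← hω] at h5
  have hω1 : ‖d.nearestRoot p‖ = 1 := Complex.norm_eq_one_of_pow_eq_one h1 (by omega)
  have hz0 : 0 ≤ h / ‖d.xi p‖ ^ r := by positivity
  set z := h / ‖d.xi p‖ ^ r with hz
  have hexp : ∀ L : ℂ, r * ‖L‖ ≤ 1.1 * z → r * ‖Complex.exp L - 1‖ ≤ 1.111 * z := by
    intro L hL
    have : ‖L‖ ≤ 1 / 100 := by nlinarith [norm_nonneg L]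
    have := norm_exp_sub_one_le_of_small this
    nlinarith
  have e1 := hexp _ h3
  have e2 := hexp _ (h6.trans (by linarith))
  have hd := d.norm_det_le p q hdet
  have e3 : d.xi p * d.eta q - d.xi q * d.eta p = d.xi p * d.xi q * d.nearestRoot p *
      ((Complex.exp (d.logRatio q) - 1) - (Complex.exp (d.logRatio p) - 1)) := by
    linear_combination d.xi p * h5 - d.xi q * h2
  rw [e3, norm_mul, norm_mul, norm_mul, hω1, mul_one] at hd
  have e4 : r * ‖(Complex.exp (d.logRatio q) - 1) - (Complex.exp (d.logRatio p) - 1)‖ ≤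
      2.222 * z := by
    have := norm_sub_le (Complex.exp (d.logRatio q) - 1) (Complex.exp (d.logRatio p) - 1)
    nlinarith
  have e5 : z * ‖d.xi p‖ ^ r = h := by rw [hz]; field_simp
  have e6 : ‖d.xi p‖ ^ r = ‖d.xi p‖ ^ (r - 1) * ‖d.xi p‖ := by
    rw [← pow_succ, Nat.sub_add_cancel (by omega)]
  set w := ‖(Complex.exp (d.logRatio q) - 1) - (Complex.exp (d.logRatio p) - 1)‖
  have hw0 : 0 ≤ w := norm_nonneg _
  -- Here r ≥ 5 is used: 2.222/5 is just below 2/4.5.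
  have e7 : w ≤ 2 / 4.5 * z := by
    have : 5 * w ≤ r * w := by gcongr
    linarith
  have hP : 0 ≤ ‖d.xi p‖ ^ (r - 1) := by positivity
  have hd' : 2 * d.halfDet ≤ ‖d.xi p‖ * ‖d.xi q‖ * (2 / 4.5 * z) := hd.trans (by gcongr)
  calc 4.5 * d.halfDet * ‖d.xi p‖ ^ (r - 1)
      = 4.5 / 2 * ((2 * d.halfDet) * ‖d.xi p‖ ^ (r - 1)) := by ring
    _ ≤ 4.5 / 2 * ((‖d.xi p‖ * ‖d.xi q‖ * (2 / 4.5 * z)) * ‖d.xi p‖ ^ (r - 1)) := by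
        exact mul_le_mul_of_nonneg_left (mul_le_mul_of_nonneg_right hd' hP) (by norm_num)
    _ = z * (‖d.xi p‖ ^ (r - 1) * ‖d.xi p‖) * ‖d.xi q‖ := by ring
    _ = h * ‖d.xi q‖ := by rw [← e6, e5]

/-- There are no three different large solutions with the same nearest root of unity. -/
theorem three_large_absurd (hr : 5 ≤ r) {h : ℤ} (hh : 0 < h)
    (hJ : (r : ℝ) ^ 7 * (h : ℝ) ^ 3 ≤ d.halfDet ^ (r - 1)) (hJ5 : r = 5 → (h : ℝ) ≤ d.halfDet)
    {p₀ p q : ℤ × ℤ} (hp₀ : p₀ ∈ primitiveSolutions F h) (hp : p ∈ primitiveSolutions F h)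
    (hq : q ∈ primitiveSolutions F h) (hl₀ : d.IsLarge p₀) (hl : d.IsLarge p) (hlq : d.IsLarge q)
    (hω₀ : d.nearestRoot p₀ = d.nearestRoot p) (hω : d.nearestRoot p = d.nearestRoot q)
    (hdet₀ : p₀.1 * p.2 - p.1 * p₀.2 ≠ 0) (hdet : p.1 * q.2 - q.1 * p.2 ≠ 0)
    (hle₀ : ‖d.xi p₀‖ ≤ ‖d.xi p‖) (hle : ‖d.xi p‖ ≤ ‖d.xi q‖) : False := by
  have hh1 : (1 : ℝ) ≤ h := by exact_mod_cast hh
  have hJ0 : 0 ≤ d.halfDet := by unfold halfDet; positivity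
  have hJ1 := one_le_of_pow_bound (by omega) hh1 hJ0 hJ
  obtain ⟨a1, a2, a3⟩ := IsLarge.norm_xi_pow hr hh hJ hp₀ hl₀
  obtain ⟨-, b2, b3⟩ := IsLarge.norm_xi_pow hr hh hJ hp hl
  obtain ⟨-, c2, c3⟩ := IsLarge.norm_xi_pow hr hh hJ hq hlq
  have g1 := d.gap hr hp₀ hp a2 a3 hle₀ hω₀ hdet₀ hh
  have g2 := d.gap hr hp hq b2 b3 hle hω hdet hh
  obtain ⟨s1, s2, s3⟩ := d.nearestRoot_spec hr hp b2 b3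
  obtain ⟨-, t2, t3⟩ := d.nearestRoot_spec hr hq c2 c3
  rw [← hω] at t2
  have hX : 16 * d.halfDet ^ 2 * (r : ℝ) ^ 7 * h ≤ ‖d.xi p‖ ^ 2 := by
    -- The constant 4.5 from the gap principle absorbs the loss 0.99 in passing from |ξ(p₀)| to the
    -- height, since 4.5 · 0.99 > 4.
    have k1 : 4 * d.halfDet * d.height p₀ ^ (r - 1) ≤ h * ‖d.xi p‖ := by
      have : 0 ≤ d.height p₀ ^ (r - 1) := pow_nonneg (d.height_nonneg _) _
      nlinarith [mul_le_mul_of_nonneg_left a1 hJ0, mul_nonneg hJ0 this]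
    have k2 : (4 * d.halfDet * d.height p₀ ^ (r - 1)) ^ 2 ≤ (h * ‖d.xi p‖) ^ 2 := by
      have : 0 ≤ d.height p₀ ^ (r - 1) := pow_nonneg (d.height_nonneg _) _
      gcongr
    have k3 : (r : ℝ) ^ 7 * (h : ℝ) ^ 3 ≤ (d.height p₀ ^ (r - 1)) ^ 2 := by
      refine hJ.trans ?_
      rw [pow_right_comm]
      have : d.halfDet ≤ d.height p₀ ^ 2 := hl₀
      gcongr
    have k4 : 16 * d.halfDet ^ 2 * ((r : ℝ) ^ 7 * (h : ℝ) ^ 3) ≤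
        16 * d.halfDet ^ 2 * (d.height p₀ ^ (r - 1)) ^ 2 := by gcongr
    have hpos : (0 : ℝ) < (h : ℝ) ^ 2 := by positivity
    refine le_of_mul_le_mul_left ?_ hpos
    nlinarith
  have hF0 : formEval F p.1 p.2 ≠ 0 := abs_pos.1 hp.2.1
  refine pade_sizes_absurd hr hh1 d.one_le_norm_s hJ1 hJ hJ5 ?_ b2 hX (Y := ‖d.xi q‖) ?_
    (fun n => (2 * r * ‖d.s‖) ^ n * ‖d.padeForm n p q‖) ?_ ?_
  · have := d.norm_s_pow_le (by omega)
    rwa [halfDet, mul_div_cancel₀ _ two_ne_zero]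
  · have : 0 ≤ d.halfDet * ‖d.xi p‖ ^ (r - 1) := by positivity
    nlinarith
  · intro n
    gcongr
    exact d.norm_padeForm_le hr n p q _ _ _ s1 s2 t2 _ _ b3 c3 s3 t3
  · intro n
    have e : 2 * d.halfDet = ‖d.α * d.δ - d.β * d.γ‖ := by
      rw [halfDet, mul_div_cancel₀ _ two_ne_zero]
    rw [e]
    rcases d.padeForm_ne_zero_or (by omega) n p q _ _ _ s1 s2 t2 (norm_pos_iff.1 b2)
      (norm_pos_iff.1 c2) hF0 with hne | hne
    · exact Or.inl (d.norm_det_le_padeForm (by omega) n p q hne)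
    · exact Or.inr (d.norm_det_le_padeForm (by omega) (n + 1) p q hne)

/-! ### From the discriminant hypothesis to the count -/

theorem size_bounds (hr : 5 ≤ r) {h : ℤ} (hh : 0 < h)
    (hΔ : (r : ℝ) ^ (7 * (r : ℝ) * ((r : ℝ) - 1) / ((r : ℝ) - 4)) *
        (h : ℝ) ^ (((r : ℝ) - 1) * ((r : ℝ) ^ 2 + (r : ℝ) + 2) / ((r : ℝ) * ((r : ℝ) - 4)))
      ≤ deltaPrime r F h) :
    (r : ℝ) ^ 7 * (h : ℝ) ^ 3 ≤ d.halfDet ^ (r - 1) ∧ (r = 5 → (h : ℝ) ≤ d.halfDet) := by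
  have hh1 : (1 : ℝ) ≤ h := by exact_mod_cast hh
  have hr' : (5 : ℝ) ≤ r := by exact_mod_cast hr
  have hJ0 : 0 ≤ d.halfDet := by unfold halfDet; positivity
  have e1 : deltaPrime r F h = d.halfDet ^ (r ^ 2 - r) / (h : ℝ) ^ (2 * r - 2) := by
    rw [deltaPrime, d.diag.abs_formDiscr (by omega),
      show ‖d.α * d.δ - d.β * d.γ‖ = 2 * d.halfDet by
        rw [halfDet, mul_div_cancel₀ _ two_ne_zero], mul_pow]
    have : (r : ℝ) ^ r ≠ 0 := by positivity
    have : (h : ℝ) ^ (2 * r - 2) ≠ 0 := by positivity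
    field_simp
  -- The hypothesis is weakened to integer exponents. With the h^(2r-2) in the denominator of Δ',
  -- r^(7r) h^(r+2) becomes (r^7 h^3)^r, to be compared with J^(r(r-1)).
  have f1 : (r : ℝ) ^ (7 * r) ≤ (r : ℝ) ^ (7 * (r : ℝ) * ((r : ℝ) - 1) / ((r : ℝ) - 4)) := by
    rw [← Real.rpow_natCast]
    refine Real.rpow_le_rpow_of_exponent_le (by linarith) ?_
    rw [le_div_iff₀ (by linarith)]
    push_cast
    nlinarith
  have f2 : (h : ℝ) ^ (r + 2) ≤
      (h : ℝ) ^ (((r : ℝ) - 1) * ((r : ℝ) ^ 2 + (r : ℝ) + 2) / ((r : ℝ) * ((r : ℝ) - 4))) := by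
    rw [← Real.rpow_natCast]
    refine Real.rpow_le_rpow_of_exponent_le hh1 ?_
    rw [le_div_iff₀ (mul_pos (by linarith) (by linarith))]
    push_cast
    nlinarith [mul_nonneg (by linarith : (0 : ℝ) ≤ r) (by linarith : (0 : ℝ) ≤ (r : ℝ) - 5)]
  rw [e1, le_div_iff₀ (by positivity)] at hΔ
  constructor
  · refine (pow_le_pow_iff_left₀ (by positivity) (by positivity) (by omega : r ≠ 0)).1 ?_
    calc ((r : ℝ) ^ 7 * (h : ℝ) ^ 3) ^ r
        = (r : ℝ) ^ (7 * r) * (h : ℝ) ^ (r + 2) * (h : ℝ) ^ (2 * r - 2) := by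
          rw [mul_pow, ← pow_mul, ← pow_mul, mul_assoc, ← pow_add]
          congr 2
          omega
      _ ≤ _ := by gcongr
      _ ≤ d.halfDet ^ (r ^ 2 - r) := hΔ
      _ = (d.halfDet ^ (r - 1)) ^ r := by
          rw [← pow_mul, Nat.sub_mul, one_mul, pow_two r]
  · rintro rfl
    refine (pow_le_pow_iff_left₀ (by positivity) (by positivity) (by norm_num : 20 ≠ 0)).1 ?_
    refine le_trans ?_ hΔ
    -- For r = 5 the exponent of h is 25.6. The value 12 suffices, as 12 + 8 = 20 = r² - r.
    have f3 : (h : ℝ) ^ 12 ≤ (h : ℝ) ^ ((((5 : ℕ) : ℝ) - 1) * (((5 : ℕ) : ℝ) ^ 2 + ((5 : ℕ) : ℝ) + 2)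
        / (((5 : ℕ) : ℝ) * (((5 : ℕ) : ℝ) - 4))) := by
      rw [← Real.rpow_natCast]
      exact Real.rpow_le_rpow_of_exponent_le hh1 (by norm_num)
    have f4 : (1 : ℝ) ≤ ((5 : ℕ) : ℝ) ^ (7 * ((5 : ℕ) : ℝ) * (((5 : ℕ) : ℝ) - 1) /
        (((5 : ℕ) : ℝ) - 4)) := Real.one_le_rpow (by norm_num) (by norm_num)
    calc (h : ℝ) ^ 20 = 1 * (h : ℝ) ^ 12 * (h : ℝ) ^ (2 * 5 - 2) := by ring
      _ ≤ _ := by gcongr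

/-- At most one pair is not large, and each root in Ω is nearest for at most two large pairs. -/
theorem numSolutions_le (hr : 5 ≤ r) {h : ℤ} (hh : 0 < h)
    (hJ : (r : ℝ) ^ 7 * (h : ℝ) ^ 3 ≤ d.halfDet ^ (r - 1)) (hJ5 : r = 5 → (h : ℝ) ≤ d.halfDet)
    (Ω : Finset ℂ)
    (hΩ : ∀ p ∈ primitiveSolutions F h, d.IsLarge p → d.nearestRoot p ∈ Ω) :
    numSolutions F h ≤ ((1 + 2 * Ω.card : ℕ) : ℕ∞) := by
  let f : ℤ × ℤ → Sym2 (ℤ × ℤ) := fun p => s(p, -p)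
  let S := primitiveSolutions F h
  have hcover : f '' S ⊆ f '' {p ∈ S | ¬ d.IsLarge p} ∪
      ⋃ ω ∈ Ω, f '' {p ∈ S | d.IsLarge p ∧ d.nearestRoot p = ω} := by
    rintro _ ⟨p, hp, rfl⟩
    by_cases hl : d.IsLarge p
    · right
      simp only [Set.mem_iUnion]
      exact ⟨_, hΩ p hp hl, p, ⟨hp, hl, rfl⟩, rfl⟩
    · exact Or.inl ⟨p, ⟨hp, hl⟩, rfl⟩
  have hsmall : (f '' {p ∈ S | ¬ d.IsLarge p}).encard ≤ 1 := by
    rw [Set.encard_le_one_iff]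
    rintro _ _ ⟨p, ⟨hp, hlp⟩, rfl⟩ ⟨q, ⟨hq, hlq⟩, rfl⟩
    by_contra hne
    rcases d.isLarge_or_isLarge p q (det_ne_zero_of_pair_ne hp hq hne) with hl | hl
    · exact hlp hl
    · exact hlq hl
  have hlarge : ∀ ω, (f '' {p ∈ S | d.IsLarge p ∧ d.nearestRoot p = ω}).encard ≤ 2 := by
    intro ω
    by_contra hcon
    have h3 : (3 : ℕ∞) ≤ (f '' {p ∈ S | d.IsLarge p ∧ d.nearestRoot p = ω}).encard := by
      rw [not_le] at hcon
      exact Order.add_one_le_of_lt hcon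
    obtain ⟨t, ht, htc⟩ := Set.exists_subset_encard_eq h3
    obtain ⟨x, y, z, hxy, hxz, hyz, rfl⟩ := Set.encard_eq_three.1 htc
    obtain ⟨p, ⟨hp, hlp, hωp⟩, rfl⟩ := ht (by simp : x ∈ ({x, y, z} : Set _))
    obtain ⟨q, ⟨hq, hlq, hωq⟩, rfl⟩ := ht (by simp : y ∈ ({f p, y, z} : Set _))
    obtain ⟨w, ⟨hw, hlw, hωw⟩, rfl⟩ := ht (by simp : z ∈ ({f p, f q, z} : Set _))
    have key : ∀ {a b c : ℤ × ℤ}, a ∈ S → b ∈ S → c ∈ S → d.IsLarge a → d.IsLarge b →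
        d.IsLarge c → d.nearestRoot a = ω → d.nearestRoot b = ω → d.nearestRoot c = ω →
        f a ≠ f b → f b ≠ f c → ‖d.xi a‖ ≤ ‖d.xi b‖ → ‖d.xi b‖ ≤ ‖d.xi c‖ → False :=
      fun ha hb hc la lb lc wa wb wc nab nbc h1 h2 =>
        d.three_large_absurd hr hh hJ hJ5 ha hb hc la lb lc (wa.trans wb.symm) (wb.trans wc.symm)
          (det_ne_zero_of_pair_ne ha hb nab) (det_ne_zero_of_pair_ne hb hc nbc) h1 h2
    -- `three_large_absurd` expects the three solutions in increasing order of |ξ|; only the two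
    -- neighbouring determinants have to be nonzero.
    rcases le_total ‖d.xi p‖ ‖d.xi q‖ with h1 | h1 <;>
    rcases le_total ‖d.xi q‖ ‖d.xi w‖ with h2 | h2 <;>
    rcases le_total ‖d.xi p‖ ‖d.xi w‖ with h3 | h3
    · exact key hp hq hw hlp hlq hlw hωp hωq hωw hxy hyz h1 h2
    · exact key hp hq hw hlp hlq hlw hωp hωq hωw hxy hyz h1 h2
    · exact key hp hw hq hlp hlw hlq hωp hωw hωq hxz hyz.symm h3 h2
    · exact key hw hp hq hlw hlp hlq hωw hωp hωq hxz.symm hxy h3 h1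
    · exact key hq hp hw hlq hlp hlw hωq hωp hωw hxy.symm hxz h1 h3
    · exact key hq hw hp hlq hlw hlp hωq hωw hωp hyz hxz.symm h2 h3
    · exact key hw hq hp hlw hlq hlp hωw hωq hωp hyz.symm hxy.symm h2 h1
    · exact key hw hq hp hlw hlq hlp hωw hωq hωp hyz.symm hxy.symm h2 h1
  calc numSolutions F h = (f '' S).encard := rfl
    _ ≤ _ := Set.encard_le_encard hcover
    _ ≤ _ := Set.encard_union_le _ _
    _ ≤ 1 + ∑ ω ∈ Ω, 2 := by
        gcongr
        exact (Finset.set_encard_biUnion_le _ _).trans (Finset.sum_le_sum fun ω _ => hlarge ω)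
    _ = ((1 + 2 * Ω.card : ℕ) : ℕ∞) := by
        rw [Finset.sum_const, nsmul_eq_mul]
        push_cast
        rw [mul_comm]

/-! ### Reality of the nearest roots and real zeros -/

theorem s_real_or_imaginary (D : ℤ) (hs : d.s ^ 2 = D) :
    (0 < D → ∃ σ : ℝ, d.s = σ) ∧ (D < 0 → ∃ σ : ℝ, d.s = σ * Complex.I) := by
  constructor
  · intro hD
    have hD' : (0 : ℝ) ≤ D := by exact_mod_cast hD.le
    have h1 : d.s ^ 2 = ((Real.sqrt D : ℝ) : ℂ) ^ 2 := by
      rw [hs, ← Complex.ofReal_pow, Real.sq_sqrt hD', Complex.ofReal_intCast]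
    rcases sq_eq_sq_iff_eq_or_eq_neg.1 h1 with h2 | h2
    · exact ⟨_, h2⟩
    · exact ⟨-Real.sqrt D, by rw [h2, Complex.ofReal_neg]⟩
  · intro hD
    have hD' : (0 : ℝ) ≤ -D := by exact_mod_cast (by omega : 0 ≤ -D)
    have h1 : d.s ^ 2 = (((Real.sqrt (-D) : ℝ) : ℂ) * Complex.I) ^ 2 := by
      rw [hs, mul_pow, Complex.I_sq, ← Complex.ofReal_pow, Real.sq_sqrt hD']
      push_cast
      ring
    rcases sq_eq_sq_iff_eq_or_eq_neg.1 h1 with h2 | h2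
    · exact ⟨_, h2⟩
    · exact ⟨-Real.sqrt (-D), by rw [h2, Complex.ofReal_neg, neg_mul]⟩

theorem two_mul_xi_pow (hr : 1 ≤ r) (p : ℤ × ℤ) : ∃ m : ℤ,
    2 * d.xi p ^ r = m / (r * d.s) + formEval F p.1 p.2 ∧
    2 * d.eta p ^ r = m / (r * d.s) - formEval F p.1 p.2 := by
  obtain ⟨m, hm⟩ := d.exists_jacobian hr p
  have hr0 : (r : ℂ) ≠ 0 := by exact_mod_cast (by omega : r ≠ 0)
  have h1 : (m : ℂ) / (r * d.s) = d.xi p ^ r + d.eta p ^ r := by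
    rw [← hm]
    have := d.s_ne_zero
    field_simp
  refine ⟨m, ?_, ?_⟩ <;> rw [h1, ← d.xi_pow_sub_eta_pow] <;> ring

/-- For real s both ξ^r and η^r are real. -/
theorem logRatio_real (hr : 1 ≤ r) {h : ℤ} {p : ℤ × ℤ} (hp : p ∈ primitiveSolutions F h)
    (hX : 0 < ‖d.xi p‖) (hz : h / ‖d.xi p‖ ^ r ≤ 1 / 100) (σ : ℝ) (hσ : d.s = σ) :
    ∃ x : ℝ, d.logRatio p = x := by
  obtain ⟨m, h1, h2⟩ := d.two_mul_xi_pow hr p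
  have hX0 : d.xi p ≠ 0 := norm_pos_iff.1 hX
  set X : ℝ := (m / (r * σ) + formEval F p.1 p.2) / 2
  set Y : ℝ := (m / (r * σ) - formEval F p.1 p.2) / 2
  have hXe : d.xi p ^ r = (X : ℂ) := by
    rw [hσ] at h1
    push_cast [X]
    linear_combination h1 / 2
  have hYe : d.eta p ^ r = (Y : ℂ) := by
    rw [hσ] at h2
    push_cast [Y]
    linear_combination h2 / 2
  have hX0' : X ≠ 0 := by
    intro h0
    rw [h0, Complex.ofReal_zero] at hXe
    exact pow_ne_zero _ hX0 hXe
  -- A negative quotient would have a principal logarithm with imaginary part π; closeness to 1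
  -- rules this out.
  have hYX : 0 ≤ Y / X := by
    have h3 := d.norm_xi_pow_sub_le hp
    rw [hXe, hYe, ← Complex.ofReal_sub, Complex.norm_real, Real.norm_eq_abs] at h3
    rw [← norm_pow, hXe, Complex.norm_real, Real.norm_eq_abs, div_le_iff₀ (abs_pos.2 hX0')] at hz
    have h4 : |X - Y| ≤ 1 / 100 * |X| := h3.trans hz
    have e : Y / X = 1 - (X - Y) / X := by field_simp; ring
    have h5 : |(X - Y) / X| ≤ 1 / 100 := by
      rw [abs_div, div_le_iff₀ (abs_pos.2 hX0')]; exact h4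
    rw [e]
    linarith [le_abs_self ((X - Y) / X)]
  refine ⟨Real.log (Y / X) / r, ?_⟩
  rw [logRatio, div_pow, hXe, hYe, ← Complex.ofReal_div, ← Complex.ofReal_log hYX]
  push_cast
  rfl

/-- For purely imaginary s, complex conjugation sends ξ^r to -η^r, so (η/ξ)^r lies on the unit
circle. -/
theorem logRatio_imaginary (hr : 1 ≤ r) (p : ℤ × ℤ) (hX : 0 < ‖d.xi p‖) (σ : ℝ)
    (hσ : d.s = σ * Complex.I) : ∃ x : ℝ, d.logRatio p = x * Complex.I := by
  obtain ⟨m, h1, h2⟩ := d.two_mul_xi_pow hr p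
  have hconj : (starRingEnd ℂ) (2 * d.xi p ^ r) = -(2 * d.eta p ^ r) := by
    rw [h1, h2, hσ]
    simp only [map_add, map_div₀, map_mul, map_intCast, map_natCast, Complex.conj_I,
      Complex.conj_ofReal, mul_neg, div_neg]
    ring
  have hnorm : ‖d.xi p ^ r‖ = ‖d.eta p ^ r‖ := by
    have := congrArg norm hconj
    rw [Complex.norm_conj, norm_neg, norm_mul, norm_mul] at this
    simpa using this
  have hu : ‖(d.eta p / d.xi p) ^ r‖ = 1 := by
    rw [div_pow, norm_div, ← hnorm, norm_pow, div_self (by positivity)]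
  refine ⟨((d.eta p / d.xi p) ^ r).arg / r, ?_⟩
  rw [logRatio, Complex.log, hu, Real.log_one]
  push_cast
  ring

/-- For real s, η(q)/ξ(q) divided by η(p)/ξ(p) is the real number (P + ks)/(P - ks), and the
logarithmic corrections at p and q are real too. -/
theorem nearestRoot_div_real (hr : 5 ≤ r) {h : ℤ} {p q : ℤ × ℤ}
    (hp : p ∈ primitiveSolutions F h) (hq : q ∈ primitiveSolutions F h)
    (hXp : 0 < ‖d.xi p‖) (hzp : h / ‖d.xi p‖ ^ r ≤ 1 / 100)
    (hXq : 0 < ‖d.xi q‖) (hzq : h / ‖d.xi q‖ ^ r ≤ 1 / 100) (σ : ℝ) (hσ : d.s = σ) :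
    ∃ t : ℝ, d.nearestRoot q = t * d.nearestRoot p ∧ t ^ r = 1 := by
  obtain ⟨x, hx⟩ := d.logRatio_real (by omega) hp hXp hzp σ hσ
  obtain ⟨y, hy⟩ := d.logRatio_real (by omega) hq hXq hzq σ hσ
  obtain ⟨p1, p2, -⟩ := d.nearestRoot_spec hr hp hXp hzp
  obtain ⟨q1, q2, -⟩ := d.nearestRoot_spec hr hq hXq hzq
  have hsub := d.xi_mul_eta_sub p q
  have hadd := d.xi_mul_eta_add p q
  set k : ℤ := p.1 * q.2 - q.1 * p.2
  set P : ℤ := 2 * d.a * p.1 * q.1 + d.b * (p.1 * q.2 + q.1 * p.2) + 2 * d.c * p.2 * q.2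
  have hXp0 : d.xi p ≠ 0 := norm_pos_iff.1 hXp
  have hXq0 : d.xi q ≠ 0 := norm_pos_iff.1 hXq
  have hωp : d.nearestRoot p ≠ 0 := by
    intro h0; rw [h0, zero_pow (by omega)] at p1; exact zero_ne_one p1
  have h1 : 2 * (d.xi q * d.eta p) = d.χ * ((P - k * σ : ℝ) : ℂ) := by
    push_cast; rw [hσ] at hsub; linear_combination hadd - hsub
  have h2 : 2 * (d.xi p * d.eta q) = d.χ * ((P + k * σ : ℝ) : ℂ) := by
    push_cast; rw [hσ] at hsub; linear_combination hadd + hsub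
  have hw : ((P - k * σ : ℝ) : ℂ) ≠ 0 := by
    intro h0
    rw [h0, mul_zero, p2] at h1
    have : d.xi q * (d.nearestRoot p * Complex.exp (d.logRatio p) * d.xi p) ≠ 0 :=
      mul_ne_zero hXq0 (mul_ne_zero (mul_ne_zero hωp (Complex.exp_ne_zero _)) hXp0)
    exact this ((mul_eq_zero.1 h1).resolve_left two_ne_zero)
  have ht : d.nearestRoot q =
      (((P + k * σ) / (P - k * σ) * Real.exp (x - y) : ℝ) : ℂ) * d.nearestRoot p := by
    have h3 : d.nearestRoot q * Complex.exp (d.logRatio q) * (P - k * σ : ℝ) =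
        d.nearestRoot p * Complex.exp (d.logRatio p) * (P + k * σ : ℝ) := by
      refine mul_left_cancel₀ (mul_ne_zero d.χ_ne_zero (mul_ne_zero hXp0 hXq0)) ?_
      linear_combination (-(d.nearestRoot q * Complex.exp (d.logRatio q) * d.xi p * d.xi q)) * h1
        + (d.nearestRoot p * Complex.exp (d.logRatio p) * d.xi p * d.xi q) * h2
        - 2 * (d.nearestRoot p * Complex.exp (d.logRatio p) * d.xi p * d.xi q) * d.xi p * q2
        + 2 * (d.nearestRoot q * Complex.exp (d.logRatio q) * d.xi p * d.xi q) * d.xi q * p2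
    rw [hx, hy] at h3
    push_cast at h3 hw ⊢
    rw [Complex.exp_sub]
    have := Complex.exp_ne_zero (y : ℂ)
    field_simp
    linear_combination h3
  refine ⟨_, ht, ?_⟩
  have h4 := q1
  rw [ht, mul_pow, p1, mul_one] at h4
  exact_mod_cast h4

/-- A form with a large solution has a nontrivial real zero. -/
theorem exists_real_zero (hr : 5 ≤ r) {h : ℤ} {p : ℤ × ℤ}
    (hp : p ∈ primitiveSolutions F h) (hX : 0 < ‖d.xi p‖) (hz : h / ‖d.xi p‖ ^ r ≤ 1 / 100) :
    ∃ x y : ℝ, (x, y) ≠ (0, 0) ∧ formEvalReal F x y = 0 := by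
  obtain ⟨h1, h2, -⟩ := d.nearestRoot_spec hr hp hX hz
  have hX0 : d.xi p ≠ 0 := norm_pos_iff.1 hX
  set ω := d.nearestRoot p
  set L := d.logRatio p with hL
  have hω : ω ≠ 0 := by
    intro h0; rw [h0, zero_pow (by omega)] at h1; exact zero_ne_one h1
  -- The real point v sought should satisfy ξ(p)η(v) = χ exp(-L/2) and ξ(v)η(p) = χ exp(L/2), so
  -- that η(v) = ωξ(v). The symmetric choice makes P and k real, because L and s are both real or
  -- both purely imaginary.
  have hPk : ∃ P k : ℝ, (P : ℂ) + k * d.s = 2 * Complex.exp (-(L / 2)) ∧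
      (P : ℂ) - k * d.s = 2 * Complex.exp (L / 2) := by
    have hD0 : d.b ^ 2 - 4 * d.a * d.c ≠ 0 := by
      intro h0
      have := d.s_sq
      rw [h0, Int.cast_zero] at this
      exact d.s_ne_zero (pow_eq_zero_iff two_ne_zero |>.1 this)
    have hs0 := d.s_ne_zero
    obtain ⟨hre, him⟩ := d.s_real_or_imaginary _ d.s_sq
    rcases lt_or_gt_of_ne hD0 with hD | hD
    · obtain ⟨σ, hσ⟩ := him hD
      obtain ⟨x, hx⟩ := d.logRatio_imaginary (by omega) p hX σ hσ
      have hσ0 : (σ : ℂ) ≠ 0 := by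
        intro h0; rw [hσ, h0, zero_mul] at hs0; exact hs0 rfl
      refine ⟨2 * Real.cos (x / 2), -2 * Real.sin (x / 2) / σ, ?_, ?_⟩
      · rw [hL, hx, hσ, show -((x : ℂ) * Complex.I / 2) = ((-(x / 2) : ℂ)) * Complex.I by ring,
          Complex.exp_mul_I, Complex.cos_neg, Complex.sin_neg]
        push_cast
        field_simp
      · rw [hL, hx, hσ, show ((x : ℂ) * Complex.I / 2) = (x / 2 : ℂ) * Complex.I by ring,
          Complex.exp_mul_I]
        push_cast
        field_simp
        ring
    · obtain ⟨σ, hσ⟩ := hre hD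
      obtain ⟨x, hx⟩ := d.logRatio_real (by omega) hp hX hz σ hσ
      have hσ0 : (σ : ℂ) ≠ 0 := by rwa [hσ] at hs0
      refine ⟨Real.exp (-(x / 2)) + Real.exp (x / 2), (Real.exp (-(x / 2)) - Real.exp (x / 2)) / σ,
        ?_, ?_⟩
      · rw [hL, hx, hσ]
        push_cast
        field_simp
        ring
      · rw [hL, hx, hσ]
        push_cast
        field_simp
        ring
  obtain ⟨P, k, e1, e2⟩ := hPk
  have hq : d.χ * ((2 * d.a * p.1 + d.b * p.2) * p.1 + (d.b * p.1 + 2 * d.c * p.2) * p.2 : ℝ) =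
      2 * (d.xi p * d.eta p) := by
    rw [xi, eta]
    push_cast
    linear_combination (-2 * (p.1 : ℂ) ^ 2) * d.coeff_xx - (2 * (p.1 : ℂ) * p.2) * d.coeff_xy -
      (2 * (p.2 : ℂ) ^ 2) * d.coeff_yy
  set A : ℝ := 2 * d.a * p.1 + d.b * p.2 with hA
  set B : ℝ := d.b * p.1 + 2 * d.c * p.2 with hB
  have hdet : A * p.1 + B * p.2 ≠ 0 := by
    intro h0
    rw [h0, Complex.ofReal_zero, mul_zero, h2] at hq
    have : d.xi p * (ω * Complex.exp L * d.xi p) ≠ 0 :=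
      mul_ne_zero hX0 (mul_ne_zero (mul_ne_zero hω (Complex.exp_ne_zero _)) hX0)
    exact this ((mul_eq_zero.1 hq.symm).resolve_left two_ne_zero)
  -- Cramer's rule for Ax + By = P and p.1 y - p.2 x = k; the determinant is twice the value of the
  -- quadratic form at p, nonzero because ξ(p)η(p) ≠ 0.
  set x : ℝ := (P * p.1 - B * k) / (A * p.1 + B * p.2) with hx
  set y : ℝ := (A * k + P * p.2) / (A * p.1 + B * p.2) with hy
  have hP : A * x + B * y = P := by rw [hx, hy]; field_simp; ring
  have hk : p.1 * y - p.2 * x = k := by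
    rw [hx, hy, mul_div_assoc', mul_div_assoc', ← sub_div, div_eq_iff hdet]; ring
  refine ⟨x, y, ?_, ?_⟩
  · intro h0
    have hx0 : x = 0 := congrArg Prod.fst h0
    have hy0 : y = 0 := congrArg Prod.snd h0
    have hP0 : P = 0 := by rw [← hP, hx0, hy0]; ring
    have hk0 : k = 0 := by rw [← hk, hx0, hy0]; ring
    rw [hP0, hk0] at e1
    simp at e1
  · have hPc : (A : ℂ) * x + B * y = P := by exact_mod_cast hP
    have hkc : (p.1 : ℂ) * y - p.2 * x = k := by exact_mod_cast hk
    rw [hA, hB] at hPc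
    push_cast at hPc
    set ξ : ℂ := d.α * x + d.β * y with hξ
    set η : ℂ := d.γ * x + d.δ * y with hη
    have f1 : d.xi p * η - ξ * d.eta p = d.χ * d.s * k := by
      rw [← hkc, ← d.det, hξ, hη, xi, eta]; ring
    have f2 : d.xi p * η + ξ * d.eta p = d.χ * P := by
      rw [← hPc, hξ, hη, xi, eta]
      linear_combination (2 * (p.1 : ℂ) * x) * d.coeff_xx +
        ((p.1 : ℂ) * y + x * p.2) * d.coeff_xy + (2 * (p.2 : ℂ) * y) * d.coeff_yy
    have hexp : Complex.exp (-(L / 2)) * Complex.exp (L / 2) * Complex.exp (L / 2) *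
        Complex.exp (L / 2) = Complex.exp L := by
      rw [← Complex.exp_add, ← Complex.exp_add, ← Complex.exp_add]; congr 1; ring
    have hexp2 : Complex.exp (-(L / 2)) * Complex.exp (L / 2) = 1 := by
      rw [← Complex.exp_add]; simp
    have f3 : d.xi p * η = d.χ * Complex.exp (-(L / 2)) := by
      linear_combination f1 / 2 + f2 / 2 + d.χ / 2 * e1
    have f4 : ξ * d.eta p = d.χ * Complex.exp (L / 2) := by
      linear_combination f2 / 2 - f1 / 2 + d.χ / 2 * e2
    have f5 : η = ω * ξ := by
      refine mul_left_cancel₀ (mul_ne_zero hX0 (Complex.exp_ne_zero L)) ?_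
      rw [h2] at f4
      rw [← hexp] at f4 ⊢
      linear_combination (Complex.exp (-(L / 2)) * Complex.exp (L / 2) * Complex.exp (L / 2) *
        Complex.exp (L / 2)) * f3 - f4 + d.χ * Complex.exp (L / 2) *
        (Complex.exp (-(L / 2)) * Complex.exp (L / 2) + 1) * hexp2
    have f6 : (formEvalReal F x y : ℂ) = 0 := by
      rw [formEvalReal_cast, d.diag.eq_sub, map_sub, map_pow, map_pow, eval_linForm, eval_linForm,
        ← hξ, ← hη, f5, mul_pow, h1, one_mul, sub_self]
    exact_mod_cast f6

/-! ### The bounds in the individual cases -/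

theorem numSolutions_le_three_mul (hr : 5 ≤ r) {h : ℤ} (hh : 0 < h)
    (hJ : (r : ℝ) ^ 7 * (h : ℝ) ^ 3 ≤ d.halfDet ^ (r - 1)) (hJ5 : r = 5 → (h : ℝ) ≤ d.halfDet) :
    numSolutions F h ≤ ((3 * r : ℕ) : ℕ∞) := by
  refine (d.numSolutions_le hr hh hJ hJ5 (Polynomial.nthRootsFinset r (1 : ℂ)) ?_).trans ?_
  · intro p hp hl
    obtain ⟨-, a2, a3⟩ := IsLarge.norm_xi_pow hr hh hJ hp hl
    rw [Polynomial.mem_nthRootsFinset (by omega)]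
    exact (d.nearestRoot_spec hr hp a2 a3).1
  · have := (Complex.isPrimitiveRoot_exp r (by omega)).card_nthRootsFinset
    rw [this]
    exact_mod_cast (by omega : 1 + 2 * r ≤ 3 * r)

/-- If the discriminant of the quadratic form is positive, then the nearest root of unity at a
large solution is determined up to sign, and if `r` is odd it is determined. -/
theorem numSolutions_le_of_real (hr : 5 ≤ r) {h : ℤ} (hh : 0 < h)
    (hJ : (r : ℝ) ^ 7 * (h : ℝ) ^ 3 ≤ d.halfDet ^ (r - 1)) (hJ5 : r = 5 → (h : ℝ) ≤ d.halfDet)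
    (σ : ℝ) (hσ : d.s = σ) :
    numSolutions F h ≤ 5 ∧ (Odd r → numSolutions F h ≤ 3) := by
  classical
  by_cases hex : ∃ p ∈ primitiveSolutions F h, d.IsLarge p
  · obtain ⟨p, hp, hl⟩ := hex
    obtain ⟨-, a2, a3⟩ := IsLarge.norm_xi_pow hr hh hJ hp hl
    have key : ∀ q ∈ primitiveSolutions F h, d.IsLarge q →
        ∃ t : ℝ, d.nearestRoot q = t * d.nearestRoot p ∧ t ^ r = 1 := by
      intro q hq hlq
      obtain ⟨-, b2, b3⟩ := IsLarge.norm_xi_pow hr hh hJ hq hlq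
      exact d.nearestRoot_div_real hr hp hq a2 a3 b2 b3 σ hσ
    constructor
    · refine (d.numSolutions_le hr hh hJ hJ5 {d.nearestRoot p, -d.nearestRoot p} ?_).trans ?_
      · intro q hq hlq
        obtain ⟨t, ht, ht1⟩ := key q hq hlq
        have habs : |t| = 1 := by
          have : |t| ^ r = 1 := by rw [← abs_pow, ht1, abs_one]
          exact (pow_eq_one_iff_of_nonneg (abs_nonneg t) (by omega)).1 this
        rcases eq_or_eq_neg_of_abs_eq habs with h1 | h1
        · simp [ht, h1]
        · simp [ht, h1]
      · have : ({d.nearestRoot p, -d.nearestRoot p} : Finset ℂ).card ≤ 2 := Finset.card_le_two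
        exact_mod_cast (by omega)
    · intro hodd
      refine (d.numSolutions_le hr hh hJ hJ5 {d.nearestRoot p} ?_).trans ?_
      · intro q hq hlq
        obtain ⟨t, ht, ht1⟩ := key q hq hlq
        have : t = 1 := hodd.strictMono_pow.injective (by simpa using ht1)
        simp [ht, this]
      · rw [Finset.card_singleton]
        norm_num
  · have h1 := d.numSolutions_le hr hh hJ hJ5 ∅ fun p hp hl => absurd ⟨p, hp, hl⟩ hex
    rw [Finset.card_empty] at h1
    exact ⟨h1.trans (by norm_num), fun _ => h1.trans (by norm_num)⟩

/-- A large solution would produce a nontrivial real zero, so Ω can be taken empty. -/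
theorem numSolutions_le_one_of_definite (hr : 5 ≤ r) {h : ℤ} (hh : 0 < h)
    (hJ : (r : ℝ) ^ 7 * (h : ℝ) ^ 3 ≤ d.halfDet ^ (r - 1)) (hJ5 : r = 5 → (h : ℝ) ≤ d.halfDet)
    (hF : IsDefiniteForm F) : numSolutions F h ≤ 1 := by
  refine (d.numSolutions_le hr hh hJ hJ5 ∅ fun p hp hl => ?_).trans (by simp)
  obtain ⟨-, a2, a3⟩ := IsLarge.norm_xi_pow hr hh hJ hp hl
  obtain ⟨x, y, hxy, h0⟩ := d.exists_real_zero hr hp a2 a3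
  rcases hF with hF | hF
  · exact absurd h0 (hF x y hxy).ne'
  · exact absurd h0 (hF x y hxy).ne

end DiagonalData

end

theorem corollary1p5 (r : ℕ) (hr : 5 ≤ r) (h : ℤ) (hh : 0 < h)
    (F : MvPolynomial (Fin 2) ℤ) (hF : IsDiagonalizable r F)
    (hΔ : (r : ℝ) ^ (7 * (r : ℝ) * ((r : ℝ) - 1) / ((r : ℝ) - 4)) *
        (h : ℝ) ^ (((r : ℝ) - 1) * ((r : ℝ) ^ 2 + (r : ℝ) + 2) / ((r : ℝ) * ((r : ℝ) - 4)))
      ≤ deltaPrime r F h) :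
    (∀ D : ℤ, IsAssociatedD r F D →
      (D < 0 → numSolutions F h ≤ ((3 * r : ℕ) : ℕ∞)) ∧
      (0 < D → Even r → IsIndefiniteForm F → numSolutions F h ≤ 6) ∧
      (0 < D → Odd r → IsIndefiniteForm F → numSolutions F h ≤ 3)) ∧
    (IsDefiniteForm F → numSolutions F h ≤ 1) := by
  constructor
  · intro D hD
    obtain ⟨d, g, hg, rfl⟩ := hD.exists_diagonalData
    obtain ⟨hJ, hJ5⟩ := d.size_bounds hr hh hΔ
    have hg2 : 0 < g ^ 2 := by positivity
    refine ⟨fun _ => d.numSolutions_le_three_mul hr hh hJ hJ5, fun hpos _ _ => ?_,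
      fun hpos hodd _ => ?_⟩
    all_goals
      obtain ⟨σ, hσ⟩ := (d.s_real_or_imaginary _ d.s_sq).1 (pos_of_mul_pos_right hpos hg2.le)
    · exact (d.numSolutions_le_of_real hr hh hJ hJ5 σ hσ).1.trans (by norm_num)
    · exact (d.numSolutions_le_of_real hr hh hJ hJ5 σ hσ).2 hodd
  · intro hdef
    -- The definite case mentions no D, so an associated quadratic form has to be produced from the
    -- diagonalization.
    obtain ⟨D, hD⟩ := hF.exists_isAssociatedD (by omega)
    obtain ⟨d, -⟩ := hD.exists_diagonalData
    obtain ⟨hJ, hJ5⟩ := d.size_bounds hr hh hΔ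
    exact d.numSolutions_le_one_of_definite hr hh hJ hJ5 hdef
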